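/- Let $n,d$ be natural numbers, $\hbar>0$, $\beta\in\mathbb R$, and let $\mathcal H=(\mathbb C^d)^{\otimes n}$. Let $H$ be a Hermitian operator on $\mathcal H$ that is invariant under all permutations of the $n$ tensor factors. For a root $\mu=(a,b)$ of $su(d)$, $a\neq b$, let $e_\mu=c_\mu|a\rangle\langle b|$ with $c_\mu\neq0$ be a non-diagonal generator of the Cartan basis, normalised so that $e_\mu^\dagger=e_{-\mu}$ where $-\mu=(b,a)$; let $E_\mu=\sum_{k=1}^n 1^{\otimes(k-1)}\otimes e_\mu\otimes 1^{\otimes(n-k)}$ be its collective representation, and let $E_\mu=\sum_\omega E_\mu(\omega)$ with $[H,E_\mu(\omega)]=\hbar\omega E_\mu(\omega)$ be its decomposition over the Bohr frequencies $\omega$ of $H$ (those $\omega$ for which $\hbar\omega$ is a difference of two eigenvalues of $H$). Consider the Lindblad generator $$\mathcal L(\rho)=-\frac{i}{\hbar}[H,\rho]+\sum_\omega\sum_{\mu,\nu}\Gamma_\omega^{\mu\nu}\Big[E_\mu(\omega)\rho E_\nu(\omega)^\dagger-\tfrac12\{E_\nu(\omega)^\dagger E_\mu(\omega),\rho\}\Big],$$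 where, for every Bohr frequency $\omega$, the matrix $(\Gamma_\omega^{\mu\nu})_{\mu,\nu}$ is Hermitian and positive semidefinite, and 1. $\Gamma_\omega^{-\mu,-\nu}=\Gamma_\omega^{\mu\nu}$ for all $\mu,\nu$ (as is the case when the coefficients are correlation functions of bath observables $B_\mu=B_{-\mu}$ coupled through $H_I=\hbar\Delta\sum_\mu E_\mu\otimes B_\mu$); 2. (detailed balance) $\Gamma_{-\omega}^{\mu\nu}=e^{\beta\hbar\omega}\,\Gamma_\omega^{\nu\mu}$ for all $\mu,\nu$. Assume further that there is a set $R$ of simple roots such that for each Bohr frequency $\omega$ the matrix $\Gamma_\omega$ has full rank over $R$ in the following sense: if $S_\omega$ is the set of roots $\mu$ with $E_\mu(\omega)\neq0$, then the range of the block $(\Gamma_\omega^{\mu\nu})_{\mu,\nu\in S_\omega}$ contains the coordinate vectors of all $\mu\in R\cap S_\omega$ (for instance, the block is invertible). Then $\mathcal H$ has a Schur basis, i.e. a unitary identification $\mathcal H\cong\bigoplus_\lambda\mathcal K^\lambda\otimes\mathcal H^\lambda$ (with $\mathcal K^\lambda\neq0$) in which $u^{\otimes n}=\bigoplus_\lambda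 1_{\mathcal K^\lambda}\otimes U^\lambda(u)$ for all $u\in SU(d)$, with pairwise inequivalent irreducible representations $U^\lambda$ of $SU(d)$ on $\mathcal H^\lambda$. In every Schur basis, $H=\bigoplus_\lambda 1_{\mathcal K^\lambda}\otimes H^\lambda$ for some operators $H^\lambda$ on $\mathcal H^\lambda$, and a density matrix $\rho$ on $\mathcal H$ is a steady state, $\mathcal L(\rho)=0$, if and only if $$\rho=\bigoplus_\lambda p^\lambda\,\sigma^\lambda\otimes\gamma^\lambda,\qquad \gamma^\lambda=\frac{e^{-\beta H^\lambda}}{\mathrm{tr}\,e^{-\beta H^\lambda}},$$ for some probabilities $p^\lambda\ge0$, $\sum_\lambda p^\lambda=1$, and some density matrices $\sigma^\lambda$ on $\mathcal K^\lambda$. -/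

import Mathlib

open scoped Matrix Kronecker ComplexOrder

namespace CollectiveThermal

/-- The product basis `|i₁⟩ ⊗ ⋯ ⊗ |iₙ⟩` of `(ℂ^d)^{⊗ n}`. -/
abbrev Config (n d : ℕ) : Type := Fin n → Fin d

/-- Operators on the ensemble Hilbert space `(ℂ^d)^{⊗ n}`, as matrices in the product basis. -/
abbrev Op (n d : ℕ) : Type := Matrix (Config n d) (Config n d) ℂ

/-- The operator `x₁ ⊗ ⋯ ⊗ xₙ`. -/
def tensorOp {n d : ℕ} (x : Fin n → Matrix (Fin d) (Fin d) ℂ) : Op n d :=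
  Matrix.of fun i j => ∏ k, x k (i k) (j k)

/-- `u^{⊗ n}`. -/
def tensorPower (n : ℕ) {d : ℕ} (u : Matrix (Fin d) (Fin d) ℂ) : Op n d :=
  tensorOp fun _ => u

/-- The collective operator `∑ₖ 1 ⊗ ⋯ ⊗ x ⊗ ⋯ ⊗ 1` (with `x` in position `k`). -/
def collective (n : ℕ) {d : ℕ} (x : Matrix (Fin d) (Fin d) ℂ) : Op n d :=
  ∑ k : Fin n, tensorOp (Function.update (fun _ => 1) k x)

/-- The operator that permutes the particles: `P_π |j⟩ = |j ∘ π⟩`. -/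
def permOp {n : ℕ} (d : ℕ) (π : Equiv.Perm (Fin n)) : Op n d :=
  Matrix.of fun i j => if i = j ∘ π then 1 else 0

/-- Invariance of an operator under all permutations of the particles. -/
def IsPermInvariant {n d : ℕ} (X : Op n d) : Prop :=
  ∀ π : Equiv.Perm (Fin n), Commute (permOp d π) X

/-- The roots of `su(d)`: ordered pairs `(a, b)` with `a ≠ b`. -/
abbrev Root (d : ℕ) : Type := {p : Fin d × Fin d // p.1 ≠ p.2}

/-- The opposite root. -/
def Root.neg {d : ℕ} (μ : Root d) : Root d := ⟨(μ.1.2, μ.1.1), μ.2.symm⟩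

/-- The root vector of `(a, b)` in the coordinates in which the diagonal matrix `D` has
`[D, |a⟩⟨b|] = (D_a - D_b) |a⟩⟨b|`. -/
def Root.vec {d : ℕ} (μ : Root d) : Fin d → ℝ := Pi.single μ.1.1 1 - Pi.single μ.1.2 1

/-- `R` is a (complete) set of simple roots: linearly independent, and every root is a combination
of elements of `R` whose integer coefficients are all nonnegative or all nonpositive. -/
def IsSimpleRoots {d : ℕ} (R : Set (Root d)) : Prop :=
  LinearIndepOn ℝ Root.vec R ∧
    ∀ μ : Root d, μ.vec ∈ AddSubmonoid.closure (Root.vec '' R) ∨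
      -μ.vec ∈ AddSubmonoid.closure (Root.vec '' R)

/-- Admissible normalisations of the non-diagonal generators `e_{ab} = c_{ab} |a⟩⟨b|`
of the Cartan basis: nonzero, with `e_μ† = e_{-μ}`. -/
def IsNormalisation {d : ℕ} (c : Root d → ℂ) : Prop :=
  ∀ μ, c μ ≠ 0 ∧ c μ.neg = star (c μ)

/-- The collective representation `E_μ` of the non-diagonal generator `e_μ`. -/
def generatorE (n : ℕ) {d : ℕ} (c : Root d → ℂ) (μ : Root d) : Op n d :=
  collective n (Matrix.single μ.1.1 μ.1.2 (c μ))

/-- The Bohr frequencies of `H`: all `ω` such that `ħ ω` is a difference of eigenvalues of `H`. -/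
noncomputable def bohrFrequencies {n d : ℕ} (ħ : ℝ) {H : Op n d} (hH : H.IsHermitian) :
    Finset ℝ :=
  Finset.univ.image fun p : Config n d × Config n d =>
    (hH.eigenvalues p.1 - hH.eigenvalues p.2) / ħ

open Classical in
/-- The Bohr-frequency component `X(ω) = ∑_{ε - ε' = ħ ω} Π_ε X Π_{ε'}` of `X`, where `Π_ε` are the
eigenprojections of `H`; it is the part of `X` with `[H, X(ω)] = ħ ω X(ω)`. -/
noncomputable def bohrComponent {n d : ℕ} (ħ : ℝ) {H : Op n d} (hH : H.IsHermitian)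
    (X : Op n d) (ω : ℝ) : Op n d :=
  let V : Op n d := hH.eigenvectorUnitary
  V * (Matrix.of fun i j =>
    if hH.eigenvalues i - hH.eigenvalues j = ħ * ω then (Vᴴ * X * V) i j else 0) * Vᴴ

/-- The Lindblad generator
`ℒ(ρ) = -(i/ħ) [H, ρ] + ∑_ω ∑_{μ,ν} Γ_ω^{μν} (E_μ(ω) ρ E_ν(ω)† - ½ {E_ν(ω)† E_μ(ω), ρ})`. -/
noncomputable def lindblad {n d : ℕ} (ħ : ℝ) {H : Op n d} (hH : H.IsHermitian)
    (c : Root d → ℂ) (Γ : ℝ → Matrix (Root d) (Root d) ℂ) (ρ : Op n d) : Op n d :=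
  let E : Root d → ℝ → Op n d := fun μ ω => bohrComponent ħ hH (generatorE n c μ) ω
  (-(Complex.I / (ħ : ℂ))) • (H * ρ - ρ * H) +
    ∑ ω ∈ bohrFrequencies ħ hH, ∑ μ, ∑ ν, Γ ω μ ν •
      (E μ ω * ρ * (E ν ω)ᴴ -
        (1 / 2 : ℂ) • ((E ν ω)ᴴ * E μ ω * ρ + ρ * ((E ν ω)ᴴ * E μ ω)))

/-- Let `S` be the set of all `μ` with `E μ ≠ 0` and `G` the block of `Γ` with rows and columns
in `S`. The matrix has full rank over `R` if every vector in the kernel of `G` vanishes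
on `R ∩ S`. For Hermitian `Γ` this says that the range of `G` contains the coordinate vectors of
`R ∩ S`; it holds in particular if `G` is invertible. -/
def HasFullRankOver {n d : ℕ} (R : Set (Root d)) (E : Root d → Op n d)
    (Γ : Matrix (Root d) (Root d) ℂ) : Prop :=
  ∀ x : Root d → ℂ, (∀ μ, E μ = 0 → x μ = 0) → (∀ μ, E μ ≠ 0 → (Γ *ᵥ x) μ = 0) →
    ∀ μ ∈ R, E μ ≠ 0 → x μ = 0

/-- Density matrices. -/
def IsDensity {ι : Type*} [Fintype ι] (ρ : Matrix ι ι ℂ) : Prop :=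
  ρ.PosSemidef ∧ ρ.trace = 1

/-- The Gibbs state `e^{-β H} / tr e^{-β H}`. -/
noncomputable def gibbs {ι : Type*} [Fintype ι] [DecidableEq ι] (β : ℝ) (H : Matrix ι ι ℂ) :
    Matrix ι ι ℂ :=
  (NormedSpace.exp (-(β : ℂ) • H)).trace⁻¹ • NormedSpace.exp (-(β : ℂ) • H)

/-- A Schur basis of `(ℂ^d)^{⊗ n}`: a unitary `W` from `⨁_l 𝒦^l ⊗ ℋ^l` onto the ensemble Hilbert
space, with `𝒦^l = ℂ^{m l}` and `ℋ^l = ℂ^{k l}`, under which `u^{⊗ n}` becomes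
`⨁_l 1 ⊗ U^l(u)` for all `u` in `SU(d)`, where the `U^l` are pairwise inequivalent irreducible
representations of `SU(d)` on `ℋ^l`. -/
structure SchurBasis (n d : ℕ) where
  /-- the labels of the irreps -/
  Λ : Type
  [fintypeΛ : Fintype Λ]
  [decEqΛ : DecidableEq Λ]
  /-- the multiplicity of each irrep -/
  m : Λ → ℕ
  /-- the dimension of each irrep -/
  k : Λ → ℕ
  m_pos : ∀ l, 0 < m l
  U : ∀ l, Representation ℂ (Matrix.specialUnitaryGroup (Fin d) ℂ) (Fin (k l) → ℂ)
  irreducible : ∀ l, (U l).IsIrreducible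
  inequivalent : ∀ l l', l ≠ l' → IsEmpty ((U l).Equiv (U l'))
  W : Matrix (Config n d) (Σ l, Fin (m l) × Fin (k l)) ℂ
  isometry : Wᴴ * W = 1
  coisometry : W * Wᴴ = 1
  decomp : ∀ u : Matrix.specialUnitaryGroup (Fin d) ℂ,
    tensorPower n (u : Matrix (Fin d) (Fin d) ℂ) =
      W * Matrix.blockDiagonal' (fun l =>
        (1 : Matrix (Fin (m l)) (Fin (m l)) ℂ) ⊗ₖ LinearMap.toMatrix' (U l u)) * Wᴴ

attribute [instance] SchurBasis.fintypeΛ SchurBasis.decEqΛ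

/-- The operator `⨁_l A^l ⊗ B^l` on the ensemble Hilbert space. -/
def SchurBasis.blockOp {n d : ℕ} (S : SchurBasis n d)
    (A : ∀ l, Matrix (Fin (S.m l)) (Fin (S.m l)) ℂ)
    (B : ∀ l, Matrix (Fin (S.k l)) (Fin (S.k l)) ℂ) : Op n d :=
  S.W * Matrix.blockDiagonal' (fun l => A l ⊗ₖ B l) * S.Wᴴ

end CollectiveThermal

/-!
Let `τ = e^{-βH}`. Every density matrix is `A τ` for a unique `A`, and the plan is to show that
`A τ` is steady exactly when `A` commutes with all collective operators.

*Detailed balance.* Since `E_μ(ω)† = E_{-μ}(-ω)` and `E_μ(ω) τ = e^{βħω} τ E_μ(ω)`, the relations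
between the coefficients `Γ_ω` give `ℒ(A τ) = 𝒦(A) τ`, where `𝒦` is a commutator with `H` plus the
dissipator in the Heisenberg picture (`lindblad_mul_exp`). If `A` commutes with `H` and the jump
operators, then clearly `𝒦(A) = 0`. Conversely `𝒦(A) = 0` implies `𝒦(A†) = 0`, and since `ℒ`
preserves the trace, `tr (𝒦(A†A) τ) = 0`. The defect of `𝒦` from being a derivation turns this into
`∑_ω ∑_{μ,ν} Γ_ω^{μν} tr ([E_ν(ω), A]† [E_μ(ω), A] τ) = 0`, a sum of nonnegative terms with `τ`
invertible. So the commutators lie, entrywise, in the kernel of `Γ_ω`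
(`mulVec_eq_zero_of_densityGenerator`), and full rank over the simple roots `R` makes `A` commute
with `E_μ` for `μ ∈ R`. The same holds for `A†`, so `A` commutes with `E_{-μ}` too.

*From simple roots to the group.* As the roots in `R` span, the graph with these edges on the levels
`1, …, d` is connected, so commutators of the `E_{±μ}` produce all collective operators up to the
collective identity, which is a scalar (`IsSimpleRoots.commute_collective`). Commuting with all
collective operators is the same as commuting with all `u^{⊗ n}`, `u ∈ SU(d)`, or with all
`x^{⊗ n}`; in one direction this uses one-parameter groups of diagonalisable matrices, in the other
that diagonalisable matrices generate all matrices. By polarisation the `x^{⊗ n}` span the operators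
invariant under permutations, `H` in particular (`IsPermInvariant.commute`).

*Schur bases.* By Schur's lemma, in a Schur basis the commutant of the `u^{⊗ n}` consists of the
operators `⨁_l Q^l ⊗ 1`, and `H`, which commutes with that commutant, is `⨁_l 1 ⊗ H^l`. Hence
`τ = ⨁_l 1 ⊗ e^{-βH^l}`, the steady states are `⨁_l Q^l ⊗ e^{-βH^l}`, and tracing out `ℋ^l` shows
that `tr(e^{-βH^l}) Q^l` is a density matrix up to a weight. A Schur basis exists because the space
is an orthogonal sum of irreducible subspaces, and equivalent summands are unitarily equivalent
(`nonempty_schurBasis`).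
-/

namespace CollectiveThermal

/-! ### Tensor powers and collective operators -/

variable {n d : ℕ}

theorem tensorOp_mul (x y : Fin n → Matrix (Fin d) (Fin d) ℂ) :
    tensorOp x * tensorOp y = tensorOp fun k => x k * y k := by
  ext i j
  simp only [Matrix.mul_apply, tensorOp, Matrix.of_apply, ← Finset.prod_mul_distrib]
  rw [Finset.prod_univ_sum, Fintype.piFinset_univ]

theorem tensorOp_diagonal (v : Fin n → Fin d → ℂ) :
    tensorOp (fun k => Matrix.diagonal (v k)) =
      Matrix.diagonal fun i : Config n d => ∏ k, v k (i k) := by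
  ext i j
  simp only [tensorOp, Matrix.of_apply, Matrix.diagonal_apply]
  split_ifs with h
  · simp [h]
  · obtain ⟨k, hk⟩ := Function.ne_iff.mp h
    exact Finset.prod_eq_zero (Finset.mem_univ k) (if_neg hk)

theorem tensorOp_conjTranspose (x : Fin n → Matrix (Fin d) (Fin d) ℂ) :
    (tensorOp x)ᴴ = tensorOp fun k => (x k)ᴴ := by
  ext i j
  simp [tensorOp, Matrix.conjTranspose_apply]

theorem tensorPower_mul (x y : Matrix (Fin d) (Fin d) ℂ) :
    tensorPower n (x * y) = tensorPower n x * tensorPower n y :=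
  (tensorOp_mul _ _).symm

theorem tensorPower_diagonal (v : Fin d → ℂ) :
    tensorPower n (Matrix.diagonal v) =
      Matrix.diagonal fun i : Config n d => ∏ k, v (i k) :=
  tensorOp_diagonal _

theorem tensorPower_one : tensorPower n (1 : Matrix (Fin d) (Fin d) ℂ) = 1 := by
  rw [← Matrix.diagonal_one, tensorPower_diagonal]
  simp

theorem tensorPower_conjTranspose (x : Matrix (Fin d) (Fin d) ℂ) :
    (tensorPower n x)ᴴ = tensorPower n xᴴ :=
  tensorOp_conjTranspose _

/-- The operator that acts as `x` on particle `k` and trivially on the others. -/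
def site (k : Fin n) (x : Matrix (Fin d) (Fin d) ℂ) : Op n d :=
  tensorOp (Function.update (fun _ => 1) k x)

theorem collective_eq_sum_site (x : Matrix (Fin d) (Fin d) ℂ) :
    collective n x = ∑ k, site k x := rfl

theorem site_apply (k : Fin n) (x : Matrix (Fin d) (Fin d) ℂ) (i j : Config n d) :
    site k x i j = x (i k) (j k) *
      ∏ l ∈ Finset.univ.erase k, (1 : Matrix (Fin d) (Fin d) ℂ) (i l) (j l) := by
  rw [site, tensorOp, Matrix.of_apply, ← Finset.mul_prod_erase _ _ (Finset.mem_univ k),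
    Function.update_self]
  congr 1
  refine Finset.prod_congr rfl fun l hl => ?_
  rw [Function.update_of_ne (Finset.ne_of_mem_erase hl)]

theorem site_add (k : Fin n) (x y : Matrix (Fin d) (Fin d) ℂ) :
    site k (x + y) = site k x + site k y := by
  ext i j
  simp [site_apply, add_mul]

theorem site_smul (k : Fin n) (a : ℂ) (x : Matrix (Fin d) (Fin d) ℂ) :
    site k (a • x) = a • site k x := by
  ext i j
  simp [site_apply, mul_assoc]

theorem site_one (k : Fin n) : site k (1 : Matrix (Fin d) (Fin d) ℂ) = 1 := by
  rw [site, Function.update_eq_self k (fun _ => (1 : Matrix (Fin d) (Fin d) ℂ))]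
  exact tensorPower_one

theorem site_mul (k : Fin n) (x y : Matrix (Fin d) (Fin d) ℂ) :
    site k x * site k y = site k (x * y) := by
  rw [site, site, tensorOp_mul, site]
  congr 1
  ext1 l
  rcases eq_or_ne l k with rfl | h
  · simp
  · simp [h]

theorem site_commute {k l : Fin n} (h : k ≠ l) (x y : Matrix (Fin d) (Fin d) ℂ) :
    site k x * site l y = site l y * site k x := by
  rw [site, site, tensorOp_mul, tensorOp_mul]
  congr 1
  ext1 m
  rcases eq_or_ne m k with rfl | hk
  · simp [h]
  · simp [hk]

/-- `x ↦ collective n x` as a linear map. -/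
def collectiveLinear (n d : ℕ) : Matrix (Fin d) (Fin d) ℂ →ₗ[ℂ] Op n d where
  toFun := collective n
  map_add' x y := by simp [collective_eq_sum_site, site_add, Finset.sum_add_distrib]
  map_smul' a x := by simp [collective_eq_sum_site, site_smul, Finset.smul_sum]

theorem collectiveLinear_apply (x : Matrix (Fin d) (Fin d) ℂ) :
    collectiveLinear n d x = collective n x := rfl

theorem collective_one : collective n (1 : Matrix (Fin d) (Fin d) ℂ) = (n : ℂ) • 1 := by
  simp [collective_eq_sum_site, site_one, Algebra.smul_def]

theorem collective_conjTranspose (x : Matrix (Fin d) (Fin d) ℂ) :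
    (collective n x)ᴴ = collective n xᴴ := by
  simp only [collective, Matrix.conjTranspose_sum, tensorOp_conjTranspose]
  refine Finset.sum_congr rfl fun k _ => congrArg _ ?_
  ext1 l
  rcases eq_or_ne l k with rfl | h
  · simp
  · simp [h]

theorem collective_bracket (x y : Matrix (Fin d) (Fin d) ℂ) :
    collective n x * collective n y - collective n y * collective n x =
      collective n (x * y - y * x) := by
  rw [← collectiveLinear_apply (x * y - y * x), map_sub]
  simp only [collectiveLinear_apply, collective_eq_sum_site, Finset.sum_mul_sum]
  rw [Finset.sum_comm (s := Finset.univ) (t := Finset.univ)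
    (f := fun i j => site i y * site j x), ← Finset.sum_sub_distrib, ← Finset.sum_sub_distrib]
  refine Finset.sum_congr rfl fun k _ => ?_
  rw [← Finset.sum_sub_distrib, Finset.sum_eq_single k]
  · rw [site_mul, site_mul]
  · intro l _ hl
    rw [site_commute hl.symm, sub_self]
  · simp

theorem collective_diagonal (v : Fin d → ℂ) :
    collective n (Matrix.diagonal v) =
      Matrix.diagonal fun i : Config n d => ∑ k, v (i k) := by
  ext i j
  simp only [collective_eq_sum_site, Matrix.sum_apply, Matrix.diagonal_apply, site_apply]
  split_ifs with h
  · subst h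
    simp
  · obtain ⟨k, hk⟩ := Function.ne_iff.mp h
    refine Finset.sum_eq_zero fun l _ => ?_
    rcases eq_or_ne l k with rfl | hl
    · simp [hk]
    · rw [Finset.prod_eq_zero (Finset.mem_erase.mpr ⟨hl.symm, Finset.mem_univ k⟩), mul_zero]
      exact Matrix.one_apply_ne hk

theorem tensorPower_mul_collective {u x y : Matrix (Fin d) (Fin d) ℂ} (h : u * x = y * u) :
    tensorPower n u * collective n x = collective n y * tensorPower n u := by
  simp only [collective, Finset.mul_sum, Finset.sum_mul, tensorPower, tensorOp_mul]
  refine Finset.sum_congr rfl fun k _ => congrArg _ ?_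
  ext1 l
  rcases eq_or_ne l k with rfl | hl
  · simp [h]
  · simp [hl]

/-! ### The commutant of the tensor powers -/

theorem commute_diagonal_iff {ι : Type*} [Fintype ι] [DecidableEq ι] {A : Matrix ι ι ℂ}
    {v : ι → ℂ} :
    Commute A (Matrix.diagonal v) ↔ ∀ i j, A i j ≠ 0 → v i = v j := by
  rw [Commute, SemiconjBy, ← Matrix.ext_iff]
  refine forall₂_congr fun i j => ?_
  rw [Matrix.mul_diagonal, Matrix.diagonal_mul, mul_comm (v i), mul_eq_mul_left_iff]
  tauto

/-- The eigenvalues of the collective operators of `|a⟩⟨a|` are the occupation numbers of the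
levels, and these determine the eigenvalues of diagonal tensor powers. -/
theorem commute_tensorPower_diagonal {A : Op n d}
    (h : ∀ v : Fin d → ℂ, Commute A (collective n (Matrix.diagonal v))) (v : Fin d → ℂ) :
    Commute A (tensorPower n (Matrix.diagonal v)) := by
  simp only [collective_diagonal, commute_diagonal_iff] at h
  rw [tensorPower_diagonal, commute_diagonal_iff]
  intro i j hA
  have hcard (a : Fin d) : (Finset.univ.filter fun k => i k = a).card =
      (Finset.univ.filter fun k => j k = a).card := by
    simpa [Pi.single_apply, Finset.sum_ite] using h (Pi.single a 1) i j hA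
  rw [← Finset.prod_fiberwise' Finset.univ i v, ← Finset.prod_fiberwise' Finset.univ j v]
  refine Finset.prod_congr rfl fun a _ => ?_
  rw [Finset.prod_const, Finset.prod_const, hcard]

theorem commute_tensorPower_conj_diagonal {A : Op n d}
    (h : ∀ x : Matrix (Fin d) (Fin d) ℂ, Commute A (collective n x))
    {u w : Matrix (Fin d) (Fin d) ℂ} (huw : u * w = 1) (v : Fin d → ℂ) :
    Commute A (tensorPower n (u * Matrix.diagonal v * w)) := by
  have hwu : w * u = 1 := mul_eq_one_comm.mp huw
  have hT : tensorPower n u * tensorPower n w = 1 := by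
    rw [← tensorPower_mul, huw, tensorPower_one]
  have hT' : tensorPower n w * tensorPower n u = 1 := mul_eq_one_comm.mp hT
  have key : Commute (tensorPower n w * A * tensorPower n u)
      (tensorPower n (Matrix.diagonal v)) := by
    refine commute_tensorPower_diagonal (fun v => ?_) v
    have h1 : tensorPower n u * collective n (Matrix.diagonal v) =
        collective n (u * Matrix.diagonal v * w) * tensorPower n u :=
      tensorPower_mul_collective (by rw [Matrix.mul_assoc _ w, hwu, mul_one])
    have h2 : tensorPower n w * collective n (u * Matrix.diagonal v * w) =
        collective n (Matrix.diagonal v) * tensorPower n w :=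
      tensorPower_mul_collective (by rw [← mul_assoc, ← mul_assoc, hwu, one_mul])
    have h3 := (h (u * Matrix.diagonal v * w)).eq
    calc tensorPower n w * A * tensorPower n u * collective n (Matrix.diagonal v)
        = tensorPower n w * (A * collective n (u * Matrix.diagonal v * w)) *
            tensorPower n u := by rw [mul_assoc, h1]; simp only [mul_assoc]
      _ = (tensorPower n w * collective n (u * Matrix.diagonal v * w)) * A *
            tensorPower n u := by rw [h3]; simp only [mul_assoc]
      _ = collective n (Matrix.diagonal v) * (tensorPower n w * A * tensorPower n u) := by
            rw [h2]; simp only [mul_assoc]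
  have key := key.eq
  rw [Commute, SemiconjBy, tensorPower_mul, tensorPower_mul]
  calc A * (tensorPower n u * tensorPower n (Matrix.diagonal v) * tensorPower n w)
      = (tensorPower n u * tensorPower n w) * A *
          (tensorPower n u * tensorPower n (Matrix.diagonal v) * tensorPower n w) := by
        rw [hT, one_mul]
    _ = tensorPower n u * (tensorPower n w * A * tensorPower n u *
          tensorPower n (Matrix.diagonal v)) * tensorPower n w := by simp only [mul_assoc]
    _ = tensorPower n u * tensorPower n (Matrix.diagonal v) * tensorPower n w * A *
          (tensorPower n u * tensorPower n w) := by rw [key]; simp only [mul_assoc]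
    _ = _ := by rw [hT, mul_one]

/-- Diagonalisable matrices generate all matrices multiplicatively, since a transvection is a
multiplicative commutator of a transvection with an invertible diagonal matrix. -/
theorem commute_tensorPower_of_collective {A : Op n d}
    (h : ∀ x : Matrix (Fin d) (Fin d) ℂ, Commute A (collective n x))
    (x : Matrix (Fin d) (Fin d) ℂ) : Commute A (tensorPower n x) := by
  have hdiag (v : Fin d → ℂ) : Commute A (tensorPower n (Matrix.diagonal v)) :=
    commute_tensorPower_diagonal (fun _ => h _) v
  refine Matrix.diagonal_transvection_induction (fun x => Commute A (tensorPower n x)) x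
    (fun v _ => hdiag v) (fun t => ?_) (fun x y hx hy => ?_)
  · obtain ⟨a, b, hab, r⟩ := t
    -- With `D` doubling coordinate `a`, one has `t⁻¹ D t = D + r |a⟩⟨b|`, which is `t D`.
    have h2 : Matrix.transvection a b r =
        (Matrix.transvection a b (-r) * Matrix.diagonal (Function.update 1 a 2) *
          Matrix.transvection a b r) * Matrix.diagonal (Function.update 1 a (1 / 2)) := by
      have hE : Matrix.single a b r * Matrix.diagonal (Function.update 1 a 2) =
          Matrix.single a b r := by
        ext i j
        by_cases hj : b = j
        · subst hj
          simp [Matrix.mul_diagonal, hab.symm]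
        · simp [Matrix.mul_diagonal, hj]
      have hE' : Matrix.single a b r * Matrix.diagonal (Function.update 1 a (1 / 2)) =
          Matrix.single a b r := by
        ext i j
        by_cases hj : b = j
        · subst hj
          simp [Matrix.mul_diagonal, hab.symm]
        · simp [Matrix.mul_diagonal, hj]
      have hD : Matrix.diagonal (Function.update (1 : Fin d → ℂ) a 2) * Matrix.single a b r =
          Matrix.single a b r + Matrix.single a b r := by
        ext i j
        by_cases hi : a = i
        · subst hi
          simp [Matrix.diagonal_mul, two_mul]
        · simp [Matrix.diagonal_mul, hi]
      have hDD : Matrix.diagonal (Function.update (1 : Fin d → ℂ) a 2) *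
          Matrix.diagonal (Function.update 1 a (1 / 2)) = 1 := by
        rw [Matrix.diagonal_mul_diagonal, ← Matrix.diagonal_one]
        congr 1
        ext1 i
        by_cases hi : i = a
        · subst hi; simp
        · simp [hi]
      have hEE : Matrix.single a b r * Matrix.single a b r = 0 :=
        Matrix.single_mul_single_of_ne _ _ _ _ hab.symm _
      rw [Matrix.transvection, Matrix.transvection, ← Matrix.single_neg, add_mul, add_mul,
        one_mul, neg_mul, hE, mul_add, mul_one, add_mul, hD, mul_add, mul_one, neg_mul, hEE, neg_zero,
        add_zero, add_mul, add_mul, hDD, neg_mul, hE']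
      abel
    change Commute A (tensorPower n (Matrix.transvection a b r))
    rw [h2, tensorPower_mul]
    refine Commute.mul_right (commute_tensorPower_conj_diagonal h ?_ _) (hdiag _)
    rw [Matrix.transvection_mul_transvection_same a b hab, neg_add_cancel, Matrix.transvection_zero]
  · simp only [tensorPower_mul]
    exact hx.mul_right hy

/-- The polarisation identity for `x ↦ x ⊗ ⋯ ⊗ x`. -/
theorem sum_perm_tensorOp (x : Fin n → Matrix (Fin d) (Fin d) ℂ) :
    ∑ π : Equiv.Perm (Fin n), tensorOp (x ∘ π) =
      ∑ s : Finset (Fin n), (-1 : ℂ) ^ s.card • tensorPower n (∑ k ∈ sᶜ, x k) := by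
  ext i j
  simp only [Matrix.sum_apply, Matrix.smul_apply, tensorPower, tensorOp, Matrix.of_apply,
    Function.comp_apply, smul_eq_mul]
  -- Expanding the products gives a sum over all maps `f`; inclusion-exclusion over the complement
  -- of the range of `f` leaves the bijective ones.
  set t : (Fin n → Fin n) → ℂ := fun f => ∏ k, x (f k) (i k) (j k) with ht
  have h1 (s : Finset (Fin n)) : ∏ k, ∑ l ∈ sᶜ, x l (i k) (j k) =
      ∑ f : Fin n → Fin n, if s ⊆ (Finset.univ.image f)ᶜ then t f else 0 := by
    rw [Finset.prod_univ_sum, ← Finset.sum_filter]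
    refine Finset.sum_congr ?_ fun _ _ => rfl
    ext f
    simp only [Fintype.mem_piFinset, Finset.mem_compl, Finset.mem_filter, Finset.mem_univ,
      true_and, Finset.subset_iff, Finset.mem_image, not_exists]
    exact ⟨fun h a ha k hk => h k (hk ▸ ha), fun h k hk => h hk k rfl⟩
  simp only [h1, Finset.mul_sum, mul_ite, mul_zero]
  rw [Finset.sum_comm]
  have h2 (f : Fin n → Fin n) : (∑ s : Finset (Fin n),
      if s ⊆ (Finset.univ.image f)ᶜ then (-1 : ℂ) ^ s.card * t f else 0) =
      if Function.Bijective f then t f else 0 := by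
    rw [← Finset.sum_filter, ← Finset.sum_mul]
    have : Finset.univ.filter (fun s => s ⊆ (Finset.univ.image f)ᶜ) =
        (Finset.univ.image f)ᶜ.powerset := by ext; simp
    rw [this]
    have h3 := congrArg (Int.cast : ℤ → ℂ)
      (Finset.sum_powerset_neg_one_pow_card (x := (Finset.univ.image f)ᶜ))
    push_cast at h3
    rw [h3]
    have h4 : (Finset.univ.image f)ᶜ = ∅ ↔ Function.Bijective f := by
      rw [Finset.compl_eq_empty_iff, Finset.eq_univ_iff_forall, ← Finite.surjective_iff_bijective]
      simp [Function.Surjective]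
    simp [h4]
  simp only [h2]
  rw [← Finset.sum_filter]
  refine Finset.sum_bij (fun π _ => ⇑π) (fun π _ => ?_) (fun π _ π' _ h => ?_) (fun f hf => ?_)
    (fun π _ => rfl)
  · exact Finset.mem_filter.mpr ⟨Finset.mem_univ _, π.bijective⟩
  · exact DFunLike.coe_injective h
  · exact ⟨Equiv.ofBijective f (Finset.mem_filter.mp hf).2, Finset.mem_univ _, rfl⟩

theorem IsPermInvariant.apply_comp {X : Op n d} (hX : IsPermInvariant X)
    (π : Equiv.Perm (Fin n)) (i j : Config n d) : X (i ∘ π) (j ∘ π) = X i j := by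
  have h := congrFun (congrFun (hX π).eq (i ∘ π)) j
  have h1 : ∀ l : Config n d, i ∘ π = l ∘ π ↔ i = l := fun l =>
    ⟨fun h => π.surjective.injective_comp_right h, fun h => h ▸ rfl⟩
  simpa [Matrix.mul_apply, permOp, h1] using h.symm

theorem eq_sum_tensorOp_single (X : Op n d) :
    X = ∑ i : Config n d, ∑ j : Config n d,
      X i j • tensorOp fun k => Matrix.single (i k) (j k) 1 := by
  ext i j
  have h (a b : Config n d) : ∏ k, (Matrix.single (a k) (b k) (1 : ℂ)) (i k) (j k) =
      if a = i ∧ b = j then 1 else 0 := by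
    simp only [Matrix.single_apply, Finset.prod_ite_zero, Finset.prod_const_one,
      Finset.mem_univ, true_imp_iff]
    simp only [forall_and, funext_iff]
  simp [Matrix.sum_apply, tensorOp, h, ite_and]

/-- One half of Schur–Weyl duality: the operators that commute with all permutations are spanned
by the tensor powers. -/
theorem IsPermInvariant.commute {X A : Op n d} (hX : IsPermInvariant X)
    (hA : ∀ x : Matrix (Fin d) (Fin d) ℂ, Commute A (tensorPower n x)) : Commute A X := by
  have h1 : (Fintype.card (Equiv.Perm (Fin n)) : ℂ) • X =
      ∑ i : Config n d, ∑ j : Config n d, X i j •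
        ∑ π : Equiv.Perm (Fin n), tensorOp ((fun k => Matrix.single (i k) (j k) 1) ∘ π) := by
    have h2 (π : Equiv.Perm (Fin n)) : X = ∑ i : Config n d, ∑ j : Config n d,
        X i j • tensorOp ((fun k => Matrix.single (i k) (j k) 1) ∘ π) := by
      conv_lhs => rw [eq_sum_tensorOp_single X]
      rw [← (π.symm.arrowCongr (Equiv.refl (Fin d))).sum_comp]
      refine Finset.sum_congr rfl fun i _ => ?_
      rw [← (π.symm.arrowCongr (Equiv.refl (Fin d))).sum_comp]
      refine Finset.sum_congr rfl fun j _ => ?_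
      have h3 (i : Config n d) : π.symm.arrowCongr (Equiv.refl (Fin d)) i = i ∘ π := rfl
      rw [h3, h3, hX.apply_comp]
      rfl
    simp only [Finset.smul_sum]
    rw [Finset.sum_congr rfl fun i _ => Finset.sum_comm, Finset.sum_comm,
      Finset.sum_congr rfl fun π _ => (h2 π).symm, Finset.sum_const, Finset.card_univ,
      Nat.cast_smul_eq_nsmul]
  have h4 : Commute A ((Fintype.card (Equiv.Perm (Fin n)) : ℂ) • X) := by
    rw [h1]
    refine Commute.sum_right _ _ _ fun i _ => Commute.sum_right _ _ _ fun j _ =>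
      Commute.smul_right ?_ _
    rw [sum_perm_tensorOp]
    exact Commute.sum_right _ _ _ fun s _ => (hA _).smul_right _
  have h5 : (Fintype.card (Equiv.Perm (Fin n)) : ℂ) ≠ 0 :=
    Nat.cast_ne_zero.mpr Fintype.card_ne_zero
  simpa [smul_smul, inv_mul_cancel₀ h5] using
    h4.smul_right ((Fintype.card (Equiv.Perm (Fin n)) : ℂ)⁻¹)

/-- Compare the derivatives at `t = 0`. -/
theorem eq_of_forall_exp_eq {x y : ℝ}
    (h : ∀ t : ℝ, Complex.exp (t * x * Complex.I) = Complex.exp (t * y * Complex.I)) : x = y := by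
  have hd (x : ℝ) : HasDerivAt (fun t : ℝ => Complex.exp (t * x * Complex.I))
      (x * Complex.I) 0 := by
    have h1 : HasDerivAt (fun t : ℝ => (t : ℂ) * x * Complex.I) (x * Complex.I) 0 := by
      simpa using ((Complex.ofRealCLM.hasDerivAt (x := (0 : ℝ))).mul_const (x : ℂ)).mul_const
        Complex.I
    simpa using h1.cexp
  have h2 := (hd x).unique (by simpa only [← funext h] using hd y)
  simpa using h2

/-- A Hermitian matrix, shifted to trace zero, generates a one-parameter subgroup of `SU(d)`; the
shift is invisible to the commutant because it acts as a scalar. -/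
theorem commute_collective_of_isHermitian {A : Op n d}
    (hA : ∀ u : Matrix.specialUnitaryGroup (Fin d) ℂ,
      Commute A (tensorPower n (u : Matrix (Fin d) (Fin d) ℂ)))
    {x : Matrix (Fin d) (Fin d) ℂ} (hx : x.IsHermitian) : Commute A (collective n x) := by
  set V : Matrix (Fin d) (Fin d) ℂ := ↑hx.eigenvectorUnitary with hV
  have hV1 : V * Vᴴ = 1 := (Matrix.mem_unitaryGroup_iff).mp hx.eigenvectorUnitary.2
  have hV2 : Vᴴ * V = 1 := (Matrix.mem_unitaryGroup_iff').mp hx.eigenvectorUnitary.2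
  set s : Fin d → ℝ := hx.eigenvalues with hs
  have hxV : x = V * Matrix.diagonal (fun a => (s a : ℂ)) * Vᴴ := by
    have := hx.spectral_theorem
    rw [Unitary.conjStarAlgAut_apply] at this
    exact this
  set T := tensorPower n V with hT
  have hT1 : T * Tᴴ = 1 := by
    rw [hT, tensorPower_conjTranspose, ← tensorPower_mul, hV1, tensorPower_one]
  have hT2 : Tᴴ * T = 1 := mul_eq_one_comm.mp hT1
  -- For `d = 0` the quotient is a junk value, but then all sums over levels vanish.
  set m : ℝ := (∑ a, s a) / d with hm
  have hm0 : ∑ a, (s a - m) = 0 := by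
    rcases Nat.eq_zero_or_pos d with rfl | hd
    · simp
    · have : (d : ℝ) ≠ 0 := by positivity
      simp [Finset.sum_sub_distrib, hm]
      field_simp
      ring
  set f : ℝ → Fin d → ℂ := fun t a => Complex.exp ((t * (s a - m) : ℝ) * Complex.I) with hf
  have hcomm (t : ℝ) : Commute (Tᴴ * A * T) (tensorPower n (Matrix.diagonal (f t))) := by
    have hmem : V * Matrix.diagonal (f t) * Vᴴ ∈ Matrix.specialUnitaryGroup (Fin d) ℂ := by
      rw [Matrix.mem_specialUnitaryGroup_iff]
      constructor
      · refine mul_mem (mul_mem hx.eigenvectorUnitary.2 ?_)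
          (Unitary.star_mem hx.eigenvectorUnitary.2)
        rw [Matrix.mem_unitaryGroup_iff, Matrix.star_eq_conjTranspose,
          Matrix.diagonal_conjTranspose, Matrix.diagonal_mul_diagonal, ← Matrix.diagonal_one]
        congr 1
        ext1 a
        simp only [hf, Pi.star_apply, RCLike.star_def, ← Complex.exp_conj, ← Complex.exp_add]
        simp
      · rw [Matrix.det_mul_right_comm, hV1, one_mul, Matrix.det_diagonal]
        simp only [hf]
        rw [← Complex.exp_sum, ← Finset.sum_mul, ← Complex.ofReal_sum, ← Finset.mul_sum, hm0]
        simp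
    have h1 := (hA ⟨_, hmem⟩).eq
    simp only [tensorPower_mul, ← tensorPower_conjTranspose] at h1
    rw [← hT] at h1
    set D := tensorPower n (Matrix.diagonal (f t))
    calc Tᴴ * A * T * D = Tᴴ * (A * (T * D * Tᴴ)) * T := by
            simp only [mul_assoc, hT2, mul_one]
      _ = (Tᴴ * T) * D * (Tᴴ * A * T) := by rw [h1]; simp only [mul_assoc]
      _ = D * (Tᴴ * A * T) := by rw [hT2, one_mul]
  have hcoll : Commute (Tᴴ * A * T) (collective n (Matrix.diagonal fun a => (s a : ℂ))) := by
    rw [collective_diagonal, commute_diagonal_iff]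
    intro i j hij
    have h2 : ∑ k, (s (i k) - m) = ∑ k, (s (j k) - m) := by
      refine eq_of_forall_exp_eq fun t => ?_
      have h3 := hcomm t
      rw [tensorPower_diagonal, commute_diagonal_iff] at h3
      have h4 := h3 i j hij
      simp only [hf, ← Complex.exp_sum, ← Finset.sum_mul, ← Complex.ofReal_sum,
        ← Finset.mul_sum] at h4
      simpa using h4
    simp only [Finset.sum_sub_distrib, sub_left_inj] at h2
    exact_mod_cast h2
  have h5 := hcoll.eq
  have h6 : collective n x = T * collective n (Matrix.diagonal fun a => (s a : ℂ)) * Tᴴ := by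
    rw [hT, tensorPower_mul_collective (y := x), ← hT, mul_assoc, hT1, mul_one]
    rw [hxV, mul_assoc _ Vᴴ, hV2, mul_one]
  rw [h6, Commute, SemiconjBy]
  set C := collective n (Matrix.diagonal fun a => (s a : ℂ))
  calc A * (T * C * Tᴴ) = (T * Tᴴ) * A * (T * C * Tᴴ) := by rw [hT1, one_mul]
    _ = T * (Tᴴ * A * T * C) * Tᴴ := by simp only [mul_assoc]
    _ = T * C * Tᴴ * A * (T * Tᴴ) := by rw [h5]; simp only [mul_assoc]
    _ = T * C * Tᴴ * A := by rw [hT1, mul_one]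

theorem commute_collective_of_specialUnitary {A : Op n d}
    (hA : ∀ u : Matrix.specialUnitaryGroup (Fin d) ℂ,
      Commute A (tensorPower n (u : Matrix (Fin d) (Fin d) ℂ)))
    (x : Matrix (Fin d) (Fin d) ℂ) : Commute A (collective n x) := by
  rw [← realPart_add_I_smul_imaginaryPart x, ← collectiveLinear_apply, map_add, map_smul,
    collectiveLinear_apply, collectiveLinear_apply]
  exact (commute_collective_of_isHermitian hA (realPart x).2).add_right
    ((commute_collective_of_isHermitian hA (imaginaryPart x).2).smul_right _)

/-! ### Commutants in a Schur basis -/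

section BlockKronecker

variable {Λ ι : Type*} [Fintype Λ] [DecidableEq Λ] {m k : Λ → ℕ}

theorem mul_blockKronecker_apply (M : Matrix ι (Σ l, Fin (m l) × Fin (k l)) ℂ)
    (P : ∀ l, Matrix (Fin (m l)) (Fin (m l)) ℂ) (X : ∀ l, Matrix (Fin (k l)) (Fin (k l)) ℂ)
    (r : ι) (l : Λ) (a : Fin (m l)) (j : Fin (k l)) :
    (M * Matrix.blockDiagonal' fun l => P l ⊗ₖ X l) r ⟨l, a, j⟩ =
      ∑ b, ∑ i, M r ⟨l, b, i⟩ * (P l b a * X l i j) := by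
  rw [Matrix.mul_apply, Fintype.sum_sigma, Finset.sum_eq_single l]
  · simp [Fintype.sum_prod_type, Matrix.blockDiagonal'_apply_eq]
  · intro l' _ hl
    refine Finset.sum_eq_zero fun x _ => ?_
    rw [Matrix.blockDiagonal'_apply_ne _ _ _ hl, mul_zero]
  · simp

theorem blockKronecker_mul_apply (M : Matrix (Σ l, Fin (m l) × Fin (k l)) ι ℂ)
    (P : ∀ l, Matrix (Fin (m l)) (Fin (m l)) ℂ) (X : ∀ l, Matrix (Fin (k l)) (Fin (k l)) ℂ)
    (r : ι) (l : Λ) (a : Fin (m l)) (i : Fin (k l)) :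
    ((Matrix.blockDiagonal' fun l => P l ⊗ₖ X l) * M) ⟨l, a, i⟩ r =
      ∑ b, ∑ j, (P l a b * X l i j) * M ⟨l, b, j⟩ r := by
  rw [Matrix.mul_apply, Fintype.sum_sigma, Finset.sum_eq_single l]
  · simp [Fintype.sum_prod_type, Matrix.blockDiagonal'_apply_eq]
  · intro l' _ hl
    refine Finset.sum_eq_zero fun x _ => ?_
    rw [Matrix.blockDiagonal'_apply_ne _ _ _ hl.symm, zero_mul]
  · simp

end BlockKronecker

/-- Schur's lemma for a matrix that intertwines inequivalent irreducible representations. -/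
theorem intertwiner_eq_zero {G : Type*} [Monoid G] {k k' : ℕ}
    {U : Representation ℂ G (Fin k → ℂ)} {U' : Representation ℂ G (Fin k' → ℂ)}
    [U.IsIrreducible] [U'.IsIrreducible] (hne : IsEmpty (U'.Equiv U))
    (X : Matrix (Fin k) (Fin k') ℂ)
    (hX : ∀ g, X * LinearMap.toMatrix' (U' g) = LinearMap.toMatrix' (U g) * X) : X = 0 := by
  let f : U'.IntertwiningMap U := ⟨Matrix.toLin' X, fun g => by
    apply LinearMap.toMatrix'.injective
    simpa [LinearMap.toMatrix'_comp] using hX g⟩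
  have hf : f = 0 := Subsingleton.elim f 0
  have h : Matrix.toLin' X = 0 := congrArg Representation.IntertwiningMap.toLinearMap hf
  simpa using h

/-- Schur's lemma for a matrix that commutes with an irreducible representation. -/
theorem intertwiner_eq_smul {G : Type*} [Monoid G] {k : ℕ}
    {U : Representation ℂ G (Fin k → ℂ)} [U.IsIrreducible]
    (X : Matrix (Fin k) (Fin k) ℂ)
    (hX : ∀ g, X * LinearMap.toMatrix' (U g) = LinearMap.toMatrix' (U g) * X) :
    ∃ c : ℂ, X = c • 1 := by
  let f : U.IntertwiningMap U := ⟨Matrix.toLin' X, fun g => by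
    apply LinearMap.toMatrix'.injective
    simpa [LinearMap.toMatrix'_comp] using hX g⟩
  obtain ⟨c, hc⟩ := (Representation.IsIrreducible.algebraMap_intertwiningMap_bijective_of_isAlgClosed
    (ρ := U)).2 f
  refine ⟨c, ?_⟩
  have h : c • LinearMap.id = Matrix.toLin' X :=
    congrArg Representation.IntertwiningMap.toLinearMap hc
  apply Matrix.toLin'.injective
  rw [← h]
  simp

theorem pos_of_isIrreducible {G : Type*} [Monoid G] {k : ℕ}
    (U : Representation ℂ G (Fin k → ℂ)) [h : U.IsIrreducible] : 0 < k := by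
  rcases Nat.eq_zero_or_pos k with rfl | hk
  · have := h.toNontrivial
    obtain ⟨σ, τ, hne⟩ := exists_pair_ne (Subrepresentation U)
    exact absurd (Subrepresentation.toSubmodule_injective (Subsingleton.elim _ _)) hne
  · exact hk

namespace SchurBasis

variable {n d : ℕ} (S : SchurBasis n d)

/-- The index set of the basis of `⨁_l 𝒦^l ⊗ ℋ^l`. -/
abbrev Index : Type := Σ l, Fin (S.m l) × Fin (S.k l)

theorem blockOp_mul (A A' : ∀ l, Matrix (Fin (S.m l)) (Fin (S.m l)) ℂ)
    (B B' : ∀ l, Matrix (Fin (S.k l)) (Fin (S.k l)) ℂ) :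
    S.blockOp A B * S.blockOp A' B' = S.blockOp (fun l => A l * A' l) (fun l => B l * B' l) := by
  simp only [blockOp, Matrix.mul_kronecker_mul, Matrix.blockDiagonal'_mul]
  simp only [Matrix.mul_assoc]
  rw [← Matrix.mul_assoc S.Wᴴ S.W, S.isometry, Matrix.one_mul]

theorem tensorPower_eq_blockOp (u : Matrix.specialUnitaryGroup (Fin d) ℂ) :
    tensorPower n (u : Matrix (Fin d) (Fin d) ℂ) =
      S.blockOp (fun _ => 1) fun l => LinearMap.toMatrix' (S.U l u) :=
  S.decomp u

theorem W_mul_mul (M : Op n d) : S.W * (S.Wᴴ * M * S.W) * S.Wᴴ = M := by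
  simp only [Matrix.mul_assoc, S.coisometry, Matrix.mul_one]
  rw [← Matrix.mul_assoc, S.coisometry, Matrix.one_mul]

theorem conj_W_blockOp (A : ∀ l, Matrix (Fin (S.m l)) (Fin (S.m l)) ℂ)
    (B : ∀ l, Matrix (Fin (S.k l)) (Fin (S.k l)) ℂ) :
    S.Wᴴ * S.blockOp A B * S.W = Matrix.blockDiagonal' fun l => A l ⊗ₖ B l := by
  simp only [blockOp, Matrix.mul_assoc, S.isometry, Matrix.mul_one]
  rw [← Matrix.mul_assoc, S.isometry, Matrix.one_mul]

theorem commute_blockOp {M : Op n d} {A : ∀ l, Matrix (Fin (S.m l)) (Fin (S.m l)) ℂ}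
    {B : ∀ l, Matrix (Fin (S.k l)) (Fin (S.k l)) ℂ} (h : Commute M (S.blockOp A B)) :
    S.Wᴴ * M * S.W * Matrix.blockDiagonal' (fun l => A l ⊗ₖ B l) =
      Matrix.blockDiagonal' (fun l => A l ⊗ₖ B l) * (S.Wᴴ * M * S.W) := by
  rw [← S.conj_W_blockOp]
  calc S.Wᴴ * M * S.W * (S.Wᴴ * S.blockOp A B * S.W)
      = S.Wᴴ * M * (S.W * S.Wᴴ) * (S.blockOp A B * S.W) := by simp only [Matrix.mul_assoc]
    _ = S.Wᴴ * (M * S.blockOp A B) * S.W := by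
      rw [S.coisometry]; simp only [Matrix.mul_assoc, Matrix.one_mul]
    _ = S.Wᴴ * S.blockOp A B * (S.W * S.Wᴴ) * M * S.W := by
      rw [h.eq, S.coisometry]; simp only [Matrix.mul_assoc, Matrix.one_mul]
    _ = _ := by simp only [Matrix.mul_assoc]

theorem exists_eq_blockOp_of_commute_tensorPower {M : Op n d}
    (hM : ∀ u : Matrix.specialUnitaryGroup (Fin d) ℂ,
      Commute M (tensorPower n (u : Matrix (Fin d) (Fin d) ℂ))) :
    ∃ Q : ∀ l, Matrix (Fin (S.m l)) (Fin (S.m l)) ℂ, M = S.blockOp Q fun _ => 1 := by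
  set N := S.Wᴴ * M * S.W with hN
  let X (l l' : S.Λ) (a : Fin (S.m l)) (a' : Fin (S.m l')) :
    Matrix (Fin (S.k l)) (Fin (S.k l')) ℂ := Matrix.of fun i j => N ⟨l, a, i⟩ ⟨l', a', j⟩
  have hX l l' a a' (u : Matrix.specialUnitaryGroup (Fin d) ℂ) :
      X l l' a a' * LinearMap.toMatrix' (S.U l' u) =
        LinearMap.toMatrix' (S.U l u) * X l l' a a' := by
    have h := hM u
    rw [S.tensorPower_eq_blockOp] at h
    ext i j
    have h1 := congrFun (congrFun (S.commute_blockOp h) ⟨l, a, i⟩) ⟨l', a', j⟩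
    rw [← hN, mul_blockKronecker_apply, blockKronecker_mul_apply] at h1
    rw [Finset.sum_comm] at h1
    clear_value N
    simpa [Matrix.one_apply, Matrix.mul_apply, X] using h1
  have := S.irreducible
  have h0 l l' (hl : l ≠ l') a a' : X l l' a a' = 0 :=
    intertwiner_eq_zero (S.inequivalent l' l hl.symm) _ (hX l l' a a')
  choose q hq using fun l a a' => intertwiner_eq_smul (X l l a a') (hX l l a a')
  refine ⟨fun l => Matrix.of (q l), ?_⟩
  rw [← S.W_mul_mul M, blockOp, ← hN]
  congr 2
  ext ⟨l, a, i⟩ ⟨l', a', j⟩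
  by_cases hl : l = l'
  · subst hl
    rw [Matrix.blockDiagonal'_apply_eq]
    exact congrFun (congrFun (hq l a a') i) j
  · rw [Matrix.blockDiagonal'_apply_ne _ _ _ hl]
    exact congrFun (congrFun (h0 l l' hl a a') i) j

theorem exists_eq_blockOp_of_commute_blockOp {M : Op n d}
    (hM : ∀ Q : ∀ l, Matrix (Fin (S.m l)) (Fin (S.m l)) ℂ,
      Commute M (S.blockOp Q fun _ => 1)) :
    ∃ B : ∀ l, Matrix (Fin (S.k l)) (Fin (S.k l)) ℂ, M = S.blockOp (fun _ => 1) B := by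
  set N := S.Wᴴ * M * S.W with hN
  have h1 (Q : ∀ l, Matrix (Fin (S.m l)) (Fin (S.m l)) ℂ) (l l' a a' i j) :
      ∑ b, N ⟨l, a, i⟩ ⟨l', b, j⟩ * Q l' b a' = ∑ b, Q l a b * N ⟨l, b, i⟩ ⟨l', a', j⟩ := by
    have h := congrFun (congrFun (S.commute_blockOp (hM Q)) ⟨l, a, i⟩) ⟨l', a', j⟩
    rw [← hN, mul_blockKronecker_apply, blockKronecker_mul_apply] at h
    clear_value N
    simpa [Matrix.one_apply] using h
  -- Commuting with the matrix units `|c⟩⟨c'|` of block `l`, and with the projection onto it, forces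
  -- `N` to be constant along the first tensor factor.
  have h2 l l' (hl : l ≠ l') a a' i j : N ⟨l, a, i⟩ ⟨l', a', j⟩ = 0 := by
    have h := h1 (Pi.single l 1) l l' a a' i j
    rw [Pi.single_eq_same, Pi.single_eq_of_ne hl.symm] at h
    simpa [Matrix.one_apply] using h.symm
  have h3 l a a' c c' i j : (if a' = c' then N ⟨l, a, i⟩ ⟨l, c, j⟩ else 0) =
      if a = c then N ⟨l, c', i⟩ ⟨l, a', j⟩ else 0 := by
    have h := h1 (Pi.single l (Matrix.single c c' 1)) l l a a' i j
    simpa [Matrix.single_apply, ite_and, eq_comm] using h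
  refine ⟨fun l => Matrix.of fun i j => N ⟨l, ⟨0, S.m_pos l⟩, i⟩ ⟨l, ⟨0, S.m_pos l⟩, j⟩, ?_⟩
  rw [← S.W_mul_mul M, blockOp, ← hN]
  congr 2
  ext ⟨l, a, i⟩ ⟨l', a', j⟩
  by_cases hl : l = l'
  · subst hl
    rw [Matrix.blockDiagonal'_apply_eq]
    simpa [Matrix.one_apply, eq_comm] using h3 l a ⟨0, S.m_pos l⟩ a' ⟨0, S.m_pos l⟩ i j
  · rw [Matrix.blockDiagonal'_apply_ne _ _ _ hl]
    exact h2 l l' hl a a' i j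

/-- The operators `⨁_l Q^l ⊗ 1` are the commutant of the tensor powers, so that an operator which
commutes with all permutations, hence with that commutant, is `⨁_l 1 ⊗ B^l`. -/
theorem exists_eq_blockOp_of_isPermInvariant {H : Op n d} (hH : IsPermInvariant H) :
    ∃ B : ∀ l, Matrix (Fin (S.k l)) (Fin (S.k l)) ℂ, H = S.blockOp (fun _ => 1) B := by
  refine S.exists_eq_blockOp_of_commute_blockOp fun Q => Commute.symm ?_
  refine hH.commute (commute_tensorPower_of_collective
    (commute_collective_of_specialUnitary fun u => ?_))
  rw [S.tensorPower_eq_blockOp, Commute, SemiconjBy, S.blockOp_mul, S.blockOp_mul]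
  simp

theorem k_pos (l : S.Λ) : 0 < S.k l :=
  have := S.irreducible l
  pos_of_isIrreducible (S.U l)

theorem blockOp_injective_right {B B' : ∀ l, Matrix (Fin (S.k l)) (Fin (S.k l)) ℂ}
    (h : S.blockOp (fun _ => 1) B = S.blockOp (fun _ => 1) B') : B = B' := by
  have h1 := congrArg (fun M => S.Wᴴ * M * S.W) h
  simp only [conj_W_blockOp] at h1
  ext l i j
  have h2 := congrFun (congrFun h1 ⟨l, ⟨0, S.m_pos l⟩, i⟩) ⟨l, ⟨0, S.m_pos l⟩, j⟩
  simpa [Matrix.blockDiagonal'_apply_eq] using h2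

theorem blockOp_conjTranspose (A : ∀ l, Matrix (Fin (S.m l)) (Fin (S.m l)) ℂ)
    (B : ∀ l, Matrix (Fin (S.k l)) (Fin (S.k l)) ℂ) :
    (S.blockOp A B)ᴴ = S.blockOp (fun l => (A l)ᴴ) fun l => (B l)ᴴ := by
  simp only [blockOp, Matrix.conjTranspose_mul, Matrix.conjTranspose_conjTranspose,
    Matrix.blockDiagonal'_conjTranspose, Matrix.conjTranspose_kronecker, Matrix.mul_assoc]

theorem isHermitian_of_blockOp {B : ∀ l, Matrix (Fin (S.k l)) (Fin (S.k l)) ℂ}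
    (h : (S.blockOp (fun _ => 1) B).IsHermitian) (l : S.Λ) : (B l).IsHermitian := by
  rw [Matrix.IsHermitian, blockOp_conjTranspose] at h
  simp only [Matrix.conjTranspose_one] at h
  exact congrFun (S.blockOp_injective_right h) l

/-- `B ↦ ⨁_l 1 ⊗ B^l` as a homomorphism of algebras. -/
def blockHom : (∀ l, Matrix (Fin (S.k l)) (Fin (S.k l)) ℂ) →ₐ[ℂ] Op n d :=
  AlgHom.ofLinearMap
    { toFun := S.blockOp fun _ => 1
      map_add' := fun B B' => by
        simp only [blockOp, Pi.add_apply, Matrix.kronecker_add]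
        rw [← Matrix.add_mul, ← Matrix.mul_add, ← Matrix.blockDiagonal'_add]
        rfl
      map_smul' := fun c B => by
        simp only [blockOp, Pi.smul_apply, Matrix.kronecker_smul, RingHom.id_apply]
        rw [← Matrix.smul_mul, ← Matrix.mul_smul, ← Matrix.blockDiagonal'_smul]
        rfl }
    (by
      have : (Matrix.blockDiagonal' fun l => (1 : Matrix (Fin (S.m l) × Fin (S.k l)) _ ℂ)) = 1 :=
        Matrix.blockDiagonal'_one
      simp [blockOp, this, S.coisometry])
    (fun B B' => by
      change S.blockOp _ _ = S.blockOp _ _ * S.blockOp _ _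
      rw [blockOp_mul]
      simp only [Matrix.one_mul]
      rfl)

open scoped Matrix.Norms.Operator in
theorem exp_blockOp (B : ∀ l, Matrix (Fin (S.k l)) (Fin (S.k l)) ℂ) :
    NormedSpace.exp (S.blockOp (fun _ => 1) B) =
      S.blockOp (fun _ => 1) fun l => NormedSpace.exp (B l) := by
  have h : Continuous S.blockHom := S.blockHom.toLinearMap.continuous_of_finiteDimensional
  have h1 := NormedSpace.map_exp S.blockHom h B
  rw [Pi.exp_def] at h1
  exact h1.symm

theorem trace_blockOp (A : ∀ l, Matrix (Fin (S.m l)) (Fin (S.m l)) ℂ)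
    (B : ∀ l, Matrix (Fin (S.k l)) (Fin (S.k l)) ℂ) :
    (S.blockOp A B).trace = ∑ l, (A l).trace * (B l).trace := by
  rw [blockOp, Matrix.trace_mul_comm, ← Matrix.mul_assoc, S.isometry, Matrix.one_mul,
    Matrix.trace_blockDiagonal']
  simp [Matrix.trace_kronecker]

open scoped MatrixOrder in
theorem posSemidef_blockOp {A : ∀ l, Matrix (Fin (S.m l)) (Fin (S.m l)) ℂ}
    {B : ∀ l, Matrix (Fin (S.k l)) (Fin (S.k l)) ℂ} (hA : ∀ l, (A l).PosSemidef)
    (hB : ∀ l, (B l).PosSemidef) : (S.blockOp A B).PosSemidef := by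
  choose f hf using fun l => CStarAlgebra.nonneg_iff_eq_star_mul_self.mp (hA l).nonneg
  choose g hg using fun l => CStarAlgebra.nonneg_iff_eq_star_mul_self.mp (hB l).nonneg
  have : S.blockOp A B = (S.blockOp f g)ᴴ * S.blockOp f g := by
    rw [blockOp_conjTranspose, blockOp_mul]
    congr 1 <;> ext1 l
    · exact hf l
    · exact hg l
  rw [this]
  exact Matrix.posSemidef_conjTranspose_mul_self _

/-- Tracing out `ℋ^l` preserves positivity. -/
theorem posSemidef_smul_of_blockOp {A : ∀ l, Matrix (Fin (S.m l)) (Fin (S.m l)) ℂ}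
    {B : ∀ l, Matrix (Fin (S.k l)) (Fin (S.k l)) ℂ} (h : (S.blockOp A B).PosSemidef) (l : S.Λ) :
    ((B l).trace • A l).PosSemidef := by
  have h1 := h.conjTranspose_mul_mul_same S.W
  rw [conj_W_blockOp] at h1
  have h2 : (B l).trace • A l = ∑ i, ((Matrix.blockDiagonal' fun l => A l ⊗ₖ B l).submatrix
      (fun a : Fin (S.m l) => (⟨l, a, i⟩ : S.Index)) fun a => ⟨l, a, i⟩) := by
    ext a b
    simp [Matrix.sum_apply, Matrix.trace, Finset.mul_sum, Matrix.blockDiagonal'_apply_eq, mul_comm]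
  rw [h2]
  exact Matrix.posSemidef_sum _ fun i _ => h1.submatrix _

end SchurBasis

/-! ### Existence of a Schur basis -/

/-- A subspace is the range of an isometric matrix, whose columns are an orthonormal basis. -/
theorem exists_isometry_of_submodule {ι : Type*} [Fintype ι] (V : Submodule ℂ (ι → ℂ)) :
    ∃ (k : ℕ) (B : Matrix ι (Fin k) ℂ), Bᴴ * B = 1 ∧ ∀ x, x ∈ V ↔ ∃ v, B *ᵥ v = x := by
  let e := WithLp.linearEquiv 2 ℂ (ι → ℂ)
  let V' : Submodule ℂ (EuclideanSpace ℂ ι) := V.comap e.toLinearMap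
  let b := stdOrthonormalBasis ℂ V'
  let B : Matrix ι (Fin (Module.finrank ℂ V')) ℂ :=
    Matrix.of fun i j => (b j : EuclideanSpace ℂ ι) i
  have hB (v) : B *ᵥ v = e ((∑ j, v j • b j : V') : EuclideanSpace ℂ ι) := by
    ext i
    simp [B, Matrix.mulVec, dotProduct, e, mul_comm]
  refine ⟨_, B, ?_, fun x => ⟨fun hx => ?_, ?_⟩⟩
  · ext i j
    have h := orthonormal_iff_ite.mp b.orthonormal i j
    rw [Submodule.coe_inner, PiLp.inner_apply] at h
    simpa [Matrix.mul_apply, B, Matrix.one_apply, mul_comm] using h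
  · refine ⟨b.repr ⟨e.symm x, by simpa [V'] using hx⟩, ?_⟩
    rw [hB, b.sum_repr]
    simp
  · rintro ⟨v, rfl⟩
    rw [hB]
    exact (∑ j, v j • b j : V').2

section UnitaryRepresentation

variable {G ι : Type*} [Group G] [Fintype ι] [DecidableEq ι] {π : G →* Matrix ι ι ℂ}

/-- An irreducible subrepresentation of the matrix representation `π`, given by an orthonormal
basis (the columns of `B`) and the representation `U` in that basis. -/
structure IrreducibleBlock (π : G →* Matrix ι ι ℂ) where
  /-- the dimension -/
  k : ℕ
  /-- the isometry onto the invariant subspace -/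
  B : Matrix ι (Fin k) ℂ
  /-- the representation in the basis formed by the columns of `B` -/
  U : Representation ℂ G (Fin k → ℂ)
  isometry : Bᴴ * B = 1
  irreducible : U.IsIrreducible
  intertwines : ∀ g, π g * B = B * LinearMap.toMatrix' (U g)

namespace IrreducibleBlock

theorem toMatrix_U (b : IrreducibleBlock π) (g : G) :
    LinearMap.toMatrix' (b.U g) = b.Bᴴ * π g * b.B := by
  rw [Matrix.mul_assoc, b.intertwines, ← Matrix.mul_assoc, b.isometry, Matrix.one_mul]

theorem toMatrix_U_inv (hπ : ∀ g, π g⁻¹ = (π g)ᴴ) (b : IrreducibleBlock π) (g : G) :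
    LinearMap.toMatrix' (b.U g⁻¹) = (LinearMap.toMatrix' (b.U g))ᴴ := by
  rw [toMatrix_U, toMatrix_U, hπ]
  simp [Matrix.conjTranspose_mul, Matrix.mul_assoc]

theorem commute_projection (hπ : ∀ g, π g⁻¹ = (π g)ᴴ) (b : IrreducibleBlock π) (g : G) :
    Commute (b.B * b.Bᴴ) (π g) := by
  have h := congrArg Matrix.conjTranspose (b.intertwines g⁻¹)
  rw [Matrix.conjTranspose_mul, Matrix.conjTranspose_mul, hπ, toMatrix_U_inv hπ,
    Matrix.conjTranspose_conjTranspose, Matrix.conjTranspose_conjTranspose] at h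
  rw [Commute, SemiconjBy, ← Matrix.mul_assoc, b.intertwines, Matrix.mul_assoc, h,
    Matrix.mul_assoc]

/-- Equivalent irreducible blocks are unitarily equivalent: the Gram matrix of an intertwiner is
scalar by Schur's lemma, so the intertwiner can be rescaled to an isometry. -/
theorem exists_isometry_of_equiv (hπ : ∀ g, π g⁻¹ = (π g)ᴴ) (b b' : IrreducibleBlock π)
    (h : Nonempty (b.U.Equiv b'.U)) :
    ∃ C : Matrix ι (Fin b.k) ℂ, Cᴴ * C = 1 ∧ C * Cᴴ = b'.B * b'.Bᴴ ∧
      ∀ g, π g * C = C * LinearMap.toMatrix' (b.U g) := by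
  obtain ⟨e⟩ := h
  have := b.irreducible
  have hk := pos_of_isIrreducible b.U
  set T := LinearMap.toMatrix' (e.toLinearEquiv : (Fin b.k → ℂ) →ₗ[ℂ] (Fin b'.k → ℂ)) with hT
  set T' := LinearMap.toMatrix' (e.toLinearEquiv.symm : (Fin b'.k → ℂ) →ₗ[ℂ] (Fin b.k → ℂ))
    with hT'
  have hTT' : T * T' = 1 := by
    rw [hT, hT', ← LinearMap.toMatrix'_comp, LinearEquiv.comp_symm, LinearMap.toMatrix'_id]
  have hT'T : T' * T = 1 := by
    rw [hT, hT', ← LinearMap.toMatrix'_comp, LinearEquiv.symm_comp, LinearMap.toMatrix'_id]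
  have hTU (g : G) : T * LinearMap.toMatrix' (b.U g) = LinearMap.toMatrix' (b'.U g) * T := by
    rw [hT, ← LinearMap.toMatrix'_comp, ← LinearMap.toMatrix'_comp]
    congr 1
    exact e.isIntertwining' g
  have hUT (g : G) : LinearMap.toMatrix' (b.U g) * Tᴴ = Tᴴ * LinearMap.toMatrix' (b'.U g) := by
    have h := congrArg Matrix.conjTranspose (hTU g⁻¹)
    rw [toMatrix_U_inv hπ, toMatrix_U_inv hπ] at h
    simpa [Matrix.conjTranspose_mul] using h
  obtain ⟨c, hc⟩ := intertwiner_eq_smul (U := b.U) (Tᴴ * T) fun g => by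
    rw [Matrix.mul_assoc, hTU, ← Matrix.mul_assoc, ← hUT, Matrix.mul_assoc]
  have hTTc : T * Tᴴ = c • 1 := by
    have h1 : Tᴴ = c • T' := by
      rw [← Matrix.mul_one Tᴴ, ← hTT', ← Matrix.mul_assoc, hc, Matrix.smul_mul, Matrix.one_mul]
    rw [h1, Matrix.mul_smul, hTT']
  have hc0 : 0 ≤ c := by
    have h1 := (Matrix.posSemidef_conjTranspose_mul_self T).diag_nonneg (i := ⟨0, hk⟩)
    rw [hc] at h1
    simpa using h1
  have hcne : c ≠ 0 := by
    rintro rfl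
    rw [zero_smul, Matrix.conjTranspose_mul_self_eq_zero] at hc
    rw [hc, Matrix.mul_zero] at hT'T
    simpa using congrFun (congrFun hT'T ⟨0, hk⟩) ⟨0, hk⟩
  obtain ⟨r, hr⟩ : ∃ r : ℝ, (r : ℂ) * r = c := by
    refine ⟨Real.sqrt c.re, ?_⟩
    rw [← Complex.ofReal_mul, Real.mul_self_sqrt (Complex.nonneg_iff.mp hc0).1]
    exact Complex.ext rfl (by simpa using (Complex.nonneg_iff.mp hc0).2)
  have hrc : (r : ℂ)⁻¹ * ((r : ℂ)⁻¹ * c) = 1 := by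
    have : (r : ℂ) ≠ 0 := fun h => hcne (by rw [← hr, h, zero_mul])
    rw [← hr]
    field_simp
  refine ⟨(r : ℂ)⁻¹ • (b'.B * T), ?_, ?_, fun g => ?_⟩
  · have h1 : Tᴴ * b'.Bᴴ * (b'.B * T) = c • 1 := by
      rw [Matrix.mul_assoc, ← Matrix.mul_assoc b'.Bᴴ, b'.isometry, Matrix.one_mul, hc]
    simp [Matrix.conjTranspose_smul, Matrix.conjTranspose_mul, h1, smul_smul, hrc]
  · have h1 : b'.B * T * (Tᴴ * b'.Bᴴ) = c • (b'.B * b'.Bᴴ) := by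
      rw [Matrix.mul_assoc, ← Matrix.mul_assoc T, hTTc, Matrix.smul_mul, Matrix.one_mul,
        Matrix.mul_smul]
    simp [Matrix.conjTranspose_smul, Matrix.conjTranspose_mul, h1, smul_smul, hrc]
  · rw [Matrix.mul_smul, Matrix.smul_mul, ← Matrix.mul_assoc, b'.intertwines, Matrix.mul_assoc,
      ← hTU, Matrix.mul_assoc]

/-- A minimal nonzero invariant subspace is an irreducible block. -/
theorem exists_of_projection {Q : Matrix ι ι ℂ} (hQ : Q ≠ 0) (hQQ : Q * Q = Q)
    (hQπ : ∀ g, Commute Q (π g)) : ∃ b : IrreducibleBlock π, Q * b.B = b.B := by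
  let P (V : Submodule ℂ (ι → ℂ)) : Prop :=
    V ≠ ⊥ ∧ (∀ x ∈ V, Q *ᵥ x = x) ∧ ∀ g, ∀ x ∈ V, π g *ᵥ x ∈ V
  have hne : {V | P V}.Nonempty := by
    refine ⟨LinearMap.range Q.mulVecLin, ?_, ?_, ?_⟩
    · rw [Ne, LinearMap.range_eq_bot]
      exact fun h => hQ (Matrix.toLin'.injective (h.trans (map_zero _).symm))
    · rintro _ ⟨x, rfl⟩
      simp [hQQ]
    · rintro g _ ⟨x, rfl⟩
      exact ⟨π g *ᵥ x, by simp [(hQπ g).eq]⟩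
  obtain ⟨V, ⟨hV0, hVQ, hVπ⟩, hmin⟩ :=
    (wellFounded_lt (α := Submodule ℂ (ι → ℂ))).has_min {V | P V} hne
  obtain ⟨k, B, hB, hBV⟩ := exists_isometry_of_submodule V
  have hBB (x) (hx : x ∈ V) : B *ᵥ (Bᴴ *ᵥ x) = x := by
    obtain ⟨v, rfl⟩ := (hBV x).mp hx
    rw [Matrix.mulVec_mulVec v, hB, Matrix.one_mulVec]
  have hBmem (v) : B *ᵥ v ∈ V := (hBV _).mpr ⟨v, rfl⟩
  have hinj (v w) (h : B *ᵥ v = B *ᵥ w) : v = w := by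
    simpa [Matrix.mulVec_mulVec, hB] using congrArg (Bᴴ *ᵥ ·) h
  have hint (g) : π g * B = B * (Bᴴ * π g * B) := by
    apply Matrix.toLin'.injective
    apply LinearMap.ext
    intro v
    have h := hBB _ (hVπ g _ (hBmem v))
    simp only [Matrix.mulVec_mulVec] at h
    rw [Matrix.toLin'_apply, Matrix.toLin'_apply, ← h, Matrix.mul_assoc Bᴴ]
  let U : Representation ℂ G (Fin k → ℂ) :=
    { toFun := fun g => Matrix.toLin' (Bᴴ * π g * B)
      map_one' := by
        rw [map_one, Matrix.mul_one, hB, Matrix.toLin'_one]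
        rfl
      map_mul' := fun g h => by
        rw [map_mul, Module.End.mul_eq_comp, ← Matrix.toLin'_mul]
        congr 1
        rw [Matrix.mul_assoc, Matrix.mul_assoc (π g), hint h]
        simp only [Matrix.mul_assoc] }
  have hU (g v) : B *ᵥ (U g v) = π g *ᵥ (B *ᵥ v) := by
    change B *ᵥ ((Bᴴ * π g * B) *ᵥ v) = _
    rw [Matrix.mulVec_mulVec, ← hint, Matrix.mulVec_mulVec]
  have hirr : U.IsIrreducible :=
    { exists_pair_ne := by
        refine ⟨⊥, ⊤, fun h => hV0 ?_⟩
        have h1 : (⊥ : Submodule ℂ (Fin k → ℂ)) = ⊤ :=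
          congrArg Subrepresentation.toSubmodule h
        rw [eq_bot_iff]
        intro x hx
        obtain ⟨v, rfl⟩ := (hBV x).mp hx
        have hv : v ∈ (⊥ : Submodule ℂ (Fin k → ℂ)) := h1 ▸ Submodule.mem_top
        rw [(Submodule.mem_bot ℂ).mp hv]
        simp
      eq_bot_or_eq_top := fun σ => by
        let V' : Submodule ℂ (ι → ℂ) := σ.toSubmodule.map B.mulVecLin
        have hV'V : V' ≤ V := by
          rintro _ ⟨v, _, rfl⟩
          exact hBmem v
        by_cases hV' : V' = ⊥
        · left
          apply Subrepresentation.toSubmodule_injective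
          change σ.toSubmodule = ⊥
          rw [eq_bot_iff]
          intro v hv
          have h1 : B *ᵥ v ∈ V' := ⟨v, hv, rfl⟩
          rw [hV', Submodule.mem_bot] at h1
          exact hinj v 0 (by rw [h1, Matrix.mulVec_zero])
        · right
          have hPV' : P V' := ⟨hV', fun x hx => hVQ x (hV'V hx), by
            rintro g _ ⟨v, hv, rfl⟩
            exact ⟨U g v, σ.apply_mem_toSubmodule g hv, hU g v⟩⟩
          have hEq : V' = V := hV'V.eq_of_not_lt (hmin V' hPV')
          apply Subrepresentation.toSubmodule_injective
          change σ.toSubmodule = ⊤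
          rw [eq_top_iff]
          intro v _
          obtain ⟨w, hw, hwv⟩ : B *ᵥ v ∈ V' := hEq ▸ hBmem v
          exact hinj w v hwv ▸ hw }
  refine ⟨⟨k, B, U, hB, hirr, fun g => ?_⟩, ?_⟩
  · change _ = B * LinearMap.toMatrix' (Matrix.toLin' (Bᴴ * π g * B))
    rw [LinearMap.toMatrix'_toLin', ← hint]
  · ext i j
    have h := hVQ _ (hBmem (Pi.single j 1))
    rw [Matrix.mulVec_mulVec] at h
    simpa using congrFun h i

/-- Every invariant projection, in particular `1`, is an orthogonal sum of irreducible blocks. -/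
theorem exists_decomposition (hπ : ∀ g, π g⁻¹ = (π g)ᴴ) (r : ℕ) {Q : Matrix ι ι ℂ}
    (hQ : Qᴴ = Q) (hQQ : Q * Q = Q) (hQπ : ∀ g, Commute Q (π g)) (hr : Q.trace.re ≤ r) :
    ∃ (I : Type) (_ : Fintype I) (b : I → IrreducibleBlock π),
      (∀ i j, i ≠ j → (b i).Bᴴ * (b j).B = 0) ∧ ∑ i, (b i).B * (b i).Bᴴ = Q := by
  induction r generalizing Q with
  | zero =>
    have hpos : Q.PosSemidef := by
      rw [← hQQ]
      nth_rw 1 [← hQ]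
      exact Matrix.posSemidef_conjTranspose_mul_self Q
    have h0 : Q = 0 := by
      rw [← hpos.trace_eq_zero_iff]
      have h1 := Complex.nonneg_iff.mp hpos.trace_nonneg
      exact Complex.ext (le_antisymm (by simpa using hr) h1.1) h1.2.symm
    exact ⟨Empty, inferInstance, fun i => i.elim, fun i => i.elim, by simp [h0]⟩
  | succ r ih =>
    rcases eq_or_ne Q 0 with rfl | h0
    · exact ⟨Empty, inferInstance, fun i => i.elim, fun i => i.elim, by simp⟩
    obtain ⟨b, hb⟩ := exists_of_projection h0 hQQ hQπ
    have := b.irreducible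
    have hk := pos_of_isIrreducible b.U
    have hbQ : b.Bᴴ * Q = b.Bᴴ := by
      simpa [Matrix.conjTranspose_mul, hQ] using congrArg Matrix.conjTranspose hb
    have hBB : b.B * b.Bᴴ * (b.B * b.Bᴴ) = b.B * b.Bᴴ := by
      rw [Matrix.mul_assoc, ← Matrix.mul_assoc b.Bᴴ, b.isometry, Matrix.one_mul]
    obtain ⟨I, _, c, hc, hsum⟩ := ih (Q := Q - b.B * b.Bᴴ)
      (by simp [Matrix.conjTranspose_mul, hQ])
      (by
        rw [mul_sub, sub_mul, sub_mul, hQQ, hBB, ← Matrix.mul_assoc Q, hb, Matrix.mul_assoc b.B,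
          hbQ]
        abel)
      (fun g => (hQπ g).sub_left (b.commute_projection hπ g))
      (by
        rw [Matrix.trace_sub, Matrix.trace_mul_comm, b.isometry, Matrix.trace_one]
        have : (1 : ℝ) ≤ b.k := by exact_mod_cast hk
        push_cast at hr
        simp
        linarith)
    -- The remaining blocks lie in the range of `Q - B B†`, which is orthogonal to that of `B`.
    have hcb (i : I) : (c i).Bᴴ * b.B = 0 := by
      have h1 : (c i).Bᴴ * (Q - b.B * b.Bᴴ) = (c i).Bᴴ := by
        classical
        rw [← hsum, Matrix.mul_sum, Finset.sum_eq_single i, ← Matrix.mul_assoc, (c i).isometry,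
          Matrix.one_mul]
        · intro j _ hj
          rw [← Matrix.mul_assoc, hc i j hj.symm, Matrix.zero_mul]
        · simp
      rw [← h1, Matrix.mul_assoc, Matrix.sub_mul, hb, Matrix.mul_assoc, b.isometry,
        Matrix.mul_one, sub_self, Matrix.mul_zero]
    have hbc (i : I) : b.Bᴴ * (c i).B = 0 := by
      simpa [Matrix.conjTranspose_mul] using congrArg Matrix.conjTranspose (hcb i)
    refine ⟨Option I, inferInstance, fun i => i.elim b c, ?_, ?_⟩
    · rintro (_ | i) (_ | j) hij
      · exact absurd rfl hij
      · exact hbc j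
      · exact hcb i
      · exact hc i j fun h => hij (congrArg some h)
    · rw [Fintype.sum_option]
      change b.B * b.Bᴴ + ∑ i, (c i).B * (c i).Bᴴ = Q
      rw [hsum, add_sub_cancel]

end IrreducibleBlock

end UnitaryRepresentation

/-- The tensor power representation of `SU(d)`. -/
def tensorPowerHom (n d : ℕ) : Matrix.specialUnitaryGroup (Fin d) ℂ →* Op n d where
  toFun u := tensorPower n (u : Matrix (Fin d) (Fin d) ℂ)
  map_one' := tensorPower_one
  map_mul' _ _ := tensorPower_mul _ _

/-- Group the blocks of an orthogonal decomposition by equivalence, and replace each block by an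
isometric copy of the representative of its class. -/
theorem nonempty_schurBasis (n d : ℕ) : Nonempty (SchurBasis n d) := by
  classical
  set π := tensorPowerHom n d with hπdef
  have hπ (g) : π g⁻¹ = (π g)ᴴ := by
    rw [hπdef]
    exact (tensorPower_conjTranspose _).symm
  obtain ⟨N, hN⟩ := exists_nat_ge (1 : Op n d).trace.re
  obtain ⟨I, _, b, horth, hsum⟩ := IrreducibleBlock.exists_decomposition hπ N
    (Q := 1) (by simp) (by simp) (fun g => Commute.one_left _) hN
  let s : Setoid I :=
    { r := fun i j => Nonempty ((b i).U.Equiv (b j).U)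
      iseqv := ⟨fun i => ⟨.refl _⟩, fun ⟨e⟩ => ⟨e.symm⟩, fun ⟨e⟩ ⟨f⟩ => ⟨e.trans f⟩⟩ }
  have hout (l : Quotient s) (i : {i // Quotient.mk s i = l}) :
      Nonempty ((b l.out).U.Equiv (b i).U) :=
    Quotient.exact (s := s) ((Quotient.out_eq l).trans i.2.symm)
  choose C hC1 hC2 hC3 using fun l i =>
    IrreducibleBlock.exists_isometry_of_equiv hπ _ _ (hout l i)
  let e (l : Quotient s) : Fin (Fintype.card {i // Quotient.mk s i = l}) ≃
    {i // Quotient.mk s i = l} := (Fintype.equivFin _).symm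
  have hCb (l) (i) : (b i.1).B * (b i.1).Bᴴ * C l i = C l i := by
    rw [← hC2, Matrix.mul_assoc, hC1, Matrix.mul_one]
  have hCC (l l') (i : {i // Quotient.mk s i = l}) (j : {i // Quotient.mk s i = l'})
      (hij : i.1 ≠ j.1) : (C l i)ᴴ * C l' j = 0 := by
    rw [← hCb l i, ← hCb l' j, Matrix.conjTranspose_mul, Matrix.conjTranspose_mul,
      Matrix.conjTranspose_conjTranspose]
    rw [Matrix.mul_assoc, Matrix.mul_assoc (b i.1).B, Matrix.mul_assoc (b j.1).B,
      ← Matrix.mul_assoc (b i.1).Bᴴ, horth _ _ hij, Matrix.zero_mul, Matrix.mul_zero,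
      Matrix.mul_zero]
  let W : Matrix (Config n d) (Σ l : Quotient s,
      Fin (Fintype.card {i // Quotient.mk s i = l}) × Fin (b l.out).k) ℂ :=
    Matrix.of fun x y => C y.1 (e y.1 y.2.1) x y.2.2
  have hW1 : Wᴴ * W = 1 := by
    ext ⟨l, a, i⟩ ⟨l', a', j⟩
    change ((C l (e l a))ᴴ * C l' (e l' a')) i j = _
    by_cases h : (⟨l, a⟩ : Σ l : Quotient s, Fin (Fintype.card {i // Quotient.mk s i = l})) =
        ⟨l', a'⟩
    · obtain ⟨rfl, h⟩ := Sigma.mk.inj_iff.mp h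
      obtain rfl := eq_of_heq h
      rw [hC1]
      simp [Matrix.one_apply]
    · rw [hCC, Matrix.zero_apply, Matrix.one_apply_ne]
      · rintro h'
        simp only [Sigma.mk.injEq] at h'
        obtain ⟨rfl, h'⟩ := h'
        have := (Prod.mk.inj (eq_of_heq h')).1
        exact h (by rw [this])
      · intro h'
        have hl : l = l' := (e l a).2.symm.trans ((congrArg _ h').trans (e l' a').2)
        subst hl
        exact h (by rw [(e l).injective (Subtype.ext h')])
  have hW2 : W * Wᴴ = 1 := by
    rw [← hsum]
    ext x y
    rw [Matrix.mul_apply, Fintype.sum_sigma, Matrix.sum_apply,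
      ← Fintype.sum_fiberwise (Quotient.mk s)]
    refine Finset.sum_congr rfl fun l _ => ?_
    rw [Fintype.sum_prod_type, ← (e l).sum_comp]
    refine Finset.sum_congr rfl fun a _ => ?_
    rw [← hC2]
    rfl
  refine ⟨{ Λ := Quotient s
            m := fun l => Fintype.card {i // Quotient.mk s i = l}
            k := fun l => (b l.out).k
            m_pos := fun l => Fintype.card_pos_iff.mpr ⟨⟨l.out, l.out_eq⟩⟩
            U := fun l => (b l.out).U
            irreducible := fun l => (b l.out).irreducible
            inequivalent := fun l l' hne => ⟨fun f => hne ?_⟩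
            W := W
            isometry := hW1
            coisometry := hW2
            decomp := fun u => ?_ }⟩
  · rw [← l.out_eq, ← l'.out_eq]
    exact Quotient.sound ⟨f⟩
  · have h : π u * W = W * Matrix.blockDiagonal' (fun l : Quotient s =>
        (1 : Matrix (Fin (Fintype.card {i // Quotient.mk s i = l})) _ ℂ) ⊗ₖ
          LinearMap.toMatrix' ((b l.out).U u)) := by
      ext x ⟨l, a, j⟩
      rw [mul_blockKronecker_apply]
      have h1 := congrFun (congrFun (hC3 l (e l a) u) x) j
      rw [Matrix.mul_apply, Matrix.mul_apply] at h1
      rw [Matrix.mul_apply]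
      refine Eq.trans h1 ?_
      simp [Matrix.one_apply, W]
    rw [← h, Matrix.mul_assoc, hW2, Matrix.mul_one]
    rfl

/-! ### Bohr frequency components -/

theorem posDef_exp_of_isHermitian {ι : Type*} [Fintype ι] [DecidableEq ι] {A : Matrix ι ι ℂ}
    (hA : A.IsHermitian) : (NormedSpace.exp A).PosDef := by
  have hS : ((1 / 2 : ℂ) • A).IsHermitian := by
    rw [Matrix.IsHermitian, Matrix.conjTranspose_smul, hA.eq]
    simp
  have h : NormedSpace.exp A =
      (NormedSpace.exp ((1 / 2 : ℂ) • A))ᴴ * NormedSpace.exp ((1 / 2 : ℂ) • A) := by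
    rw [hS.exp.eq, ← Matrix.exp_add_of_commute _ _ (Commute.refl _), ← add_smul]
    norm_num
  rw [Matrix.PosSemidef.posDef_iff_isUnit]
  · exact Matrix.isUnit_exp A
  · rw [h]
    exact Matrix.posSemidef_conjTranspose_mul_self _

theorem isHermitian_ofReal_smul {ι : Type*} {H : Matrix ι ι ℂ} (hH : H.IsHermitian) (r : ℝ) :
    (-(r : ℂ) • H).IsHermitian := by
  rw [Matrix.IsHermitian, Matrix.conjTranspose_smul, hH.eq]
  simp

section Bohr

variable {n d : ℕ} {H : Op n d} (ħ : ℝ) (hH : H.IsHermitian)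

/-- Passage to the matrix elements in the eigenbasis of `H`. -/
noncomputable def toEigenbasis : Op n d ≃⋆ₐ[ℂ] Op n d :=
  (Unitary.conjStarAlgAut ℂ (Op n d) hH.eigenvectorUnitary).symm

theorem toEigenbasis_apply (X : Op n d) : toEigenbasis hH X =
    (hH.eigenvectorUnitary : Op n d)ᴴ * X * (hH.eigenvectorUnitary : Op n d) :=
  Unitary.conjStarAlgAut_symm_apply _ _

theorem toEigenbasis_injective : Function.Injective (toEigenbasis hH) :=
  EquivLike.injective _

theorem toEigenbasis_conjTranspose (X : Op n d) :
    toEigenbasis hH Xᴴ = (toEigenbasis hH X)ᴴ :=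
  map_star _ X

theorem toEigenbasis_self :
    toEigenbasis hH H = Matrix.diagonal fun i => (hH.eigenvalues i : ℂ) := by
  have h := hH.spectral_theorem
  apply EquivLike.injective (toEigenbasis hH).symm
  rw [StarAlgEquiv.symm_apply_apply]
  exact h

open Classical in
theorem toEigenbasis_bohrComponent (X : Op n d) (ω : ℝ) :
    toEigenbasis hH (bohrComponent ħ hH X ω) = Matrix.of fun i j =>
      if hH.eigenvalues i - hH.eigenvalues j = ħ * ω then toEigenbasis hH X i j else 0 := by
  apply EquivLike.injective (toEigenbasis hH).symm
  rw [StarAlgEquiv.symm_apply_apply, toEigenbasis_apply]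
  exact (Unitary.conjStarAlgAut_apply _ _).symm

open scoped Matrix.Norms.Operator in
theorem toEigenbasis_exp_eq (X : Op n d) :
    toEigenbasis hH (NormedSpace.exp X) = NormedSpace.exp (toEigenbasis hH X) :=
  NormedSpace.map_exp (toEigenbasis hH)
    (toEigenbasis hH).toAlgEquiv.toLinearMap.continuous_of_finiteDimensional X

theorem toEigenbasis_exp (β : ℝ) :
    toEigenbasis hH (NormedSpace.exp (-(β : ℂ) • H)) =
      Matrix.diagonal fun i => Complex.exp (-(β * hH.eigenvalues i)) := by
  rw [toEigenbasis_exp_eq, map_smul, toEigenbasis_self, ← Matrix.diagonal_smul,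
    Matrix.exp_diagonal]
  congr 1
  ext1 i
  rw [Pi.coe_exp, ← Complex.exp_eq_exp_ℂ]
  simp

theorem neg_mem_bohrFrequencies {ω : ℝ} (h : ω ∈ bohrFrequencies ħ hH) :
    -ω ∈ bohrFrequencies ħ hH := by
  simp only [bohrFrequencies, Finset.mem_image, Finset.mem_univ, true_and] at h ⊢
  obtain ⟨⟨i, j⟩, rfl⟩ := h
  exact ⟨⟨j, i⟩, by ring⟩

theorem sum_bohrComponent {ħ : ℝ} (hħ : ħ ≠ 0) (X : Op n d) :
    ∑ ω ∈ bohrFrequencies ħ hH, bohrComponent ħ hH X ω = X := by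
  apply toEigenbasis_injective hH
  rw [map_sum]
  ext i j
  simp only [toEigenbasis_bohrComponent, Matrix.sum_apply, Matrix.of_apply]
  rw [Finset.sum_eq_single ((hH.eigenvalues i - hH.eigenvalues j) / ħ)]
  · rw [if_pos (mul_div_cancel₀ _ hħ).symm]
  · intro ω _ hω
    rw [if_neg]
    exact fun h => hω (by rw [h, mul_div_cancel_left₀ _ hħ])
  · intro h
    exact absurd (Finset.mem_image.mpr ⟨(i, j), Finset.mem_univ _, rfl⟩) h

theorem bohrComponent_conjTranspose (X : Op n d) (ω : ℝ) :
    (bohrComponent ħ hH X ω)ᴴ = bohrComponent ħ hH Xᴴ (-ω) := by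
  apply toEigenbasis_injective hH
  rw [toEigenbasis_conjTranspose, toEigenbasis_bohrComponent, toEigenbasis_bohrComponent,
    toEigenbasis_conjTranspose]
  ext i j
  have : hH.eigenvalues j - hH.eigenvalues i = ħ * ω ↔
      hH.eigenvalues i - hH.eigenvalues j = ħ * -ω := by
    constructor <;> intro h <;> linarith
  simp only [Matrix.conjTranspose_apply, Matrix.of_apply, this]
  split_ifs <;> simp

theorem commute_bohrComponent {A X : Op n d} (hAH : Commute A H) (hAX : Commute A X) (ω : ℝ) :
    Commute A (bohrComponent ħ hH X ω) := by
  have h1 := hAH.map (toEigenbasis hH)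
  rw [toEigenbasis_self, commute_diagonal_iff] at h1
  have h2 := (hAX.map (toEigenbasis hH)).eq
  apply toEigenbasis_injective hH
  rw [map_mul, map_mul, toEigenbasis_bohrComponent]
  set a := toEigenbasis hH A
  set x := toEigenbasis hH X
  have h3 (i j) : hH.eigenvalues i = hH.eigenvalues j ∨ a i j = 0 := by
    by_cases h : a i j = 0
    · exact Or.inr h
    · exact Or.inl (by exact_mod_cast h1 i j h)
  ext i j
  have h4 := congrFun (congrFun h2 i) j
  simp only [Matrix.mul_apply, Matrix.of_apply] at h4 ⊢
  by_cases h : hH.eigenvalues i - hH.eigenvalues j = ħ * ω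
  · refine Eq.trans ?_ (h4.trans ?_) <;> refine Finset.sum_congr rfl fun k _ => ?_
    · rcases h3 i k with hk | hk
      · rw [if_pos (hk ▸ h)]
      · simp [hk]
    · rcases h3 k j with hk | hk
      · rw [if_pos (hk ▸ h)]
      · simp [hk]
  · refine (Finset.sum_eq_zero fun k _ => ?_).trans (Finset.sum_eq_zero fun k _ => ?_).symm
    · rcases h3 i k with hk | hk
      · rw [if_neg (hk ▸ h), mul_zero]
      · simp [hk]
    · rcases h3 k j with hk | hk
      · rw [if_neg (hk ▸ h), zero_mul]
      · simp [hk]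

theorem bohrComponent_mul_exp (β : ℝ) (X : Op n d) (ω : ℝ) :
    bohrComponent ħ hH X ω * NormedSpace.exp (-(β : ℂ) • H) =
      (Real.exp (β * ħ * ω) : ℂ) •
        (NormedSpace.exp (-(β : ℂ) • H) * bohrComponent ħ hH X ω) := by
  apply toEigenbasis_injective hH
  rw [map_smul, map_mul, map_mul, toEigenbasis_bohrComponent, toEigenbasis_exp]
  ext i j
  simp only [Matrix.mul_diagonal, Matrix.smul_apply, Matrix.diagonal_mul, Matrix.of_apply,
    smul_eq_mul]
  split_ifs with h
  · rw [← mul_assoc, mul_comm, Complex.ofReal_exp, ← Complex.exp_add]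
    congr 2
    have h' : (hH.eigenvalues i : ℂ) - hH.eigenvalues j = ħ * ω := by exact_mod_cast h
    push_cast
    linear_combination (β : ℂ) * h'
  · simp

end Bohr

/-! ### Lindblad generators with detailed balance -/

section Generator

variable {ι M : Type*} [Fintype ι] [Fintype M]

/-- The generator `ρ ↦ κ [H, ρ] + 𝒟(ρ)` with jump operators `E μ ω` and coefficients `Γ ω μ ν`. -/
noncomputable def stateGenerator (κ : ℂ) (H : Matrix ι ι ℂ) (Ω : Finset ℝ)
    (E : M → ℝ → Matrix ι ι ℂ) (Γ : ℝ → Matrix M M ℂ) (ρ : Matrix ι ι ℂ) : Matrix ι ι ℂ :=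
  κ • (H * ρ - ρ * H) + ∑ ω ∈ Ω, ∑ μ, ∑ ν, Γ ω μ ν •
    (E μ ω * ρ * (E ν ω)ᴴ -
      (1 / 2 : ℂ) • ((E ν ω)ᴴ * E μ ω * ρ + ρ * ((E ν ω)ᴴ * E μ ω)))

/-- The map `A ↦ κ [H, A] + 𝒟†(A)`, where `𝒟†` is the dissipator in the Heisenberg picture. (The
Heisenberg generator itself has the opposite sign in front of the commutator.) -/
noncomputable def densityGenerator (κ : ℂ) (H : Matrix ι ι ℂ) (Ω : Finset ℝ)
    (E : M → ℝ → Matrix ι ι ℂ) (Γ : ℝ → Matrix M M ℂ) (A : Matrix ι ι ℂ) : Matrix ι ι ℂ :=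
  κ • (H * A - A * H) + ∑ ω ∈ Ω, ∑ μ, ∑ ν, Γ ω μ ν •
    ((E ν ω)ᴴ * A * E μ ω -
      (1 / 2 : ℂ) • ((E ν ω)ᴴ * E μ ω * A + A * ((E ν ω)ᴴ * E μ ω)))

variable {κ : ℂ} {H : Matrix ι ι ℂ} {Ω : Finset ℝ} {E : M → ℝ → Matrix ι ι ℂ}
  {Γ : ℝ → Matrix M M ℂ}

theorem trace_stateGenerator (ρ : Matrix ι ι ℂ) : (stateGenerator κ H Ω E Γ ρ).trace = 0 := by
  have h (μ ν ω) : (E μ ω * ρ * (E ν ω)ᴴ - (1 / 2 : ℂ) • ((E ν ω)ᴴ * E μ ω * ρ +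
      ρ * ((E ν ω)ᴴ * E μ ω))).trace = 0 := by
    rw [Matrix.trace_sub, Matrix.trace_smul, Matrix.trace_add, Matrix.trace_mul_comm ρ,
      Matrix.trace_mul_comm (E μ ω * ρ), ← Matrix.mul_assoc, smul_eq_mul]
    ring
  simp [stateGenerator, Matrix.trace_add, Matrix.trace_sub, Matrix.trace_sum, h,
    Matrix.trace_mul_comm H ρ, -one_div, -smul_add]

theorem densityGenerator_conjTranspose (hκ : star κ = -κ) (hH : H.IsHermitian)
    (hΓ : ∀ ω ∈ Ω, (Γ ω).IsHermitian) (A : Matrix ι ι ℂ) :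
    densityGenerator κ H Ω E Γ Aᴴ = (densityGenerator κ H Ω E Γ A)ᴴ := by
  simp only [densityGenerator, Matrix.conjTranspose_add, Matrix.conjTranspose_sum]
  congr 1
  · simp only [Matrix.conjTranspose_smul, hκ, Matrix.conjTranspose_sub,
      Matrix.conjTranspose_mul, hH.eq]
    module
  · refine Finset.sum_congr rfl fun ω hω => ?_
    rw [Finset.sum_comm]
    refine Finset.sum_congr rfl fun ν _ => Finset.sum_congr rfl fun μ _ => ?_
    rw [Matrix.conjTranspose_smul, (hΓ ω hω).apply]
    simp only [Matrix.conjTranspose_smul, Matrix.conjTranspose_sub, Matrix.conjTranspose_add,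
      Matrix.conjTranspose_mul, Matrix.conjTranspose_conjTranspose, Matrix.mul_assoc]
    simp [add_comm]

/-- The failure of the generator to be a derivation (the carré du champ). -/
theorem densityGenerator_mul (B A : Matrix ι ι ℂ) :
    densityGenerator κ H Ω E Γ (B * A) = densityGenerator κ H Ω E Γ B * A +
      B * densityGenerator κ H Ω E Γ A + ∑ ω ∈ Ω, ∑ μ, ∑ ν, Γ ω μ ν •
        (((E ν ω)ᴴ * B - B * (E ν ω)ᴴ) * (A * E μ ω - E μ ω * A)) := by
  have h1 : κ • (H * (B * A) - B * A * H) = κ • (H * B - B * H) * A + B * κ • (H * A - A * H) := by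
    rw [Matrix.smul_mul, Matrix.mul_smul, ← smul_add]
    congr 1
    noncomm_ring
  simp only [densityGenerator, add_mul, mul_add, Finset.sum_mul, Finset.mul_sum]
  rw [h1]
  have h2 : ∀ ω μ ν, Γ ω μ ν • ((E ν ω)ᴴ * (B * A) * E μ ω -
      (1 / 2 : ℂ) • ((E ν ω)ᴴ * E μ ω * (B * A) + B * A * ((E ν ω)ᴴ * E μ ω))) =
      Γ ω μ ν • ((E ν ω)ᴴ * B * E μ ω -
      (1 / 2 : ℂ) • ((E ν ω)ᴴ * E μ ω * B + B * ((E ν ω)ᴴ * E μ ω))) * A +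
      B * Γ ω μ ν • ((E ν ω)ᴴ * A * E μ ω -
      (1 / 2 : ℂ) • ((E ν ω)ᴴ * E μ ω * A + A * ((E ν ω)ᴴ * E μ ω))) +
      Γ ω μ ν • (((E ν ω)ᴴ * B - B * (E ν ω)ᴴ) * (A * E μ ω - E μ ω * A)) := by
    intro ω μ ν
    rw [Matrix.smul_mul, Matrix.mul_smul, ← smul_add, ← smul_add]
    congr 1
    simp only [Matrix.sub_mul, Matrix.mul_sub, Matrix.smul_mul, Matrix.mul_smul, Matrix.add_mul,
      Matrix.mul_add, Matrix.mul_assoc]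
    module
  simp only [h2, Finset.sum_add_distrib]
  abel

theorem densityGenerator_eq_zero_of_commute {A : Matrix ι ι ℂ} (hAH : Commute A H)
    (hAE : ∀ μ ω, Commute A (E μ ω)) (hAE' : ∀ μ ω, Commute A (E μ ω)ᴴ) :
    densityGenerator κ H Ω E Γ A = 0 := by
  have h (ω μ ν) : (E ν ω)ᴴ * A * E μ ω - (1 / 2 : ℂ) • ((E ν ω)ᴴ * E μ ω * A +
      A * ((E ν ω)ᴴ * E μ ω)) = 0 := by
    rw [← Matrix.mul_assoc A, (hAE' ν ω).eq, Matrix.mul_assoc (E ν ω)ᴴ A, (hAE μ ω).eq,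
      ← Matrix.mul_assoc]
    module
  simp only [densityGenerator, h, hAH.eq]
  simp

open scoped MatrixOrder in
/-- Write `𝒦` for `densityGenerator`. If `𝒦(A) = 0`, `𝒦(A†) = 0`, and the invertible positive operator
`S S†` satisfies `tr (𝒦(B) S S†) = 0` for all `B`, then the carré du champ of `A` has vanishing
trace against `S S†`, which puts the commutators `[E_μ(ω), A]`, entrywise, into the kernel of
`Γ_ω`. -/
theorem mulVec_eq_zero_of_densityGenerator [DecidableEq ι]
    (hΓ : ∀ ω ∈ Ω, (Γ ω).PosSemidef)
    {A S : Matrix ι ι ℂ} (hS : IsUnit S)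
    (htr : ∀ B, (densityGenerator κ H Ω E Γ B * (S * Sᴴ)).trace = 0)
    (hA : densityGenerator κ H Ω E Γ A = 0) (hA' : densityGenerator κ H Ω E Γ Aᴴ = 0)
    {ω : ℝ} (hω : ω ∈ Ω) (i j : ι) :
    Γ ω *ᵥ (fun μ => star ((A * E μ ω - E μ ω * A) i j)) = 0 := by
  classical
  have hex (ω : ℝ) : ∃ F : Matrix M M ℂ, ω ∈ Ω → Γ ω = Fᴴ * F := by
    by_cases h : ω ∈ Ω
    · obtain ⟨F, hF⟩ := CStarAlgebra.nonneg_iff_eq_star_mul_self.mp (hΓ ω h).nonneg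
      exact ⟨F, fun _ => hF⟩
    · exact ⟨0, fun h' => absurd h' h⟩
  choose F hF using hex
  let C (μ : M) (ω : ℝ) := A * E μ ω - E μ ω * A
  -- With `Γ = F† F`, the carré du champ becomes a sum of squares `L† L`.
  let L (ω : ℝ) (a : M) : Matrix ι ι ℂ := ∑ μ, star (F ω a μ) • C μ ω
  have hsum : ∑ ω ∈ Ω, ∑ a, ((L ω a * S)ᴴ * (L ω a * S)).trace = 0 := by
    have h1 := htr (Aᴴ * A)
    rw [densityGenerator_mul, hA, hA', Matrix.zero_mul, Matrix.mul_zero, add_zero, zero_add] at h1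
    have h2 : ∑ ω ∈ Ω, ∑ μ, ∑ ν, Γ ω μ ν •
        (((E ν ω)ᴴ * Aᴴ - Aᴴ * (E ν ω)ᴴ) * (A * E μ ω - E μ ω * A)) =
        ∑ ω ∈ Ω, ∑ a, (L ω a)ᴴ * L ω a := by
      refine Finset.sum_congr rfl fun ω hω => ?_
      have h3 (μ ν : M) : Γ ω μ ν • (((E ν ω)ᴴ * Aᴴ - Aᴴ * (E ν ω)ᴴ) *
          (A * E μ ω - E μ ω * A)) =
          ∑ a, (star (F ω a μ) * F ω a ν) • ((C ν ω)ᴴ * C μ ω) := by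
        rw [← Finset.sum_smul, hF ω hω, Matrix.mul_apply]
        simp [C, Matrix.conjTranspose_mul]
      simp only [h3]
      rw [Finset.sum_congr rfl fun μ _ => Finset.sum_comm, Finset.sum_comm]
      refine Finset.sum_congr rfl fun a _ => ?_
      simp only [L, Matrix.conjTranspose_sum, Matrix.conjTranspose_smul, star_star,
        Matrix.sum_mul, Matrix.mul_sum, Matrix.smul_mul, Matrix.mul_smul, Finset.smul_sum, smul_smul]
    rw [h2, Matrix.sum_mul, Matrix.trace_sum] at h1
    rw [← h1]
    refine Finset.sum_congr rfl fun ω _ => ?_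
    rw [Matrix.sum_mul, Matrix.trace_sum]
    refine Finset.sum_congr rfl fun a _ => ?_
    rw [Matrix.conjTranspose_mul, ← Matrix.mul_assoc _ S, Matrix.trace_mul_comm _ Sᴴ,
      Matrix.mul_assoc, Matrix.mul_assoc]
  have hnn (ω a) : 0 ≤ ((L ω a * S)ᴴ * (L ω a * S)).trace :=
    (Matrix.posSemidef_conjTranspose_mul_self _).trace_nonneg
  have hL (a : M) : L ω a = 0 := by
    have h1 := (Finset.sum_eq_zero_iff_of_nonneg fun ω _ =>
      Finset.sum_nonneg fun a _ => hnn ω a).mp hsum ω hω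
    have h2 := (Finset.sum_eq_zero_iff_of_nonneg fun a _ => hnn ω a).mp h1 a (Finset.mem_univ a)
    rw [Matrix.trace_conjTranspose_mul_self_eq_zero_iff] at h2
    exact hS.mul_left_eq_zero.mp h2
  rw [hF ω hω, ← Matrix.mulVec_mulVec]
  have h3 : F ω *ᵥ (fun μ => star (C μ ω i j)) = 0 := by
    ext a
    have h4 := congrArg star (congrFun (congrFun (hL a) i) j)
    simpa [L, Matrix.sum_apply, Matrix.mulVec, dotProduct] using h4
  rw [h3, Matrix.mulVec_zero]

end Generator

section Lindblad

variable {n d : ℕ} {ħ β : ℝ} {H : Op n d} {hH : H.IsHermitian} {c : Root d → ℂ}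
  {Γ : ℝ → Matrix (Root d) (Root d) ℂ}

theorem Root.neg_neg (μ : Root d) : μ.neg.neg = μ := rfl

theorem generatorE_conjTranspose (hc : IsNormalisation c) (μ : Root d) :
    (generatorE n c μ)ᴴ = generatorE n c μ.neg := by
  rw [generatorE, collective_conjTranspose, Matrix.conjTranspose_single, ← (hc μ).2]
  rfl

theorem sum_bohrFrequencies_neg {N : Type*} [AddCommMonoid N] (f : ℝ → N) :
    ∑ ω ∈ bohrFrequencies ħ hH, f (-ω) = ∑ ω ∈ bohrFrequencies ħ hH, f ω :=
  Finset.sum_nbij' (fun ω => -ω) (fun ω => -ω) (fun _ h => neg_mem_bohrFrequencies ħ hH h)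
    (fun _ h => neg_mem_bohrFrequencies ħ hH h) (fun _ _ => _root_.neg_neg _)
    (fun _ _ => _root_.neg_neg _) fun _ _ => rfl

theorem sum_root_neg {N : Type*} [AddCommMonoid N] (f : Root d → N) :
    ∑ μ : Root d, f μ.neg = ∑ μ, f μ :=
  Function.Bijective.sum_comp (Function.Involutive.bijective Root.neg_neg) f

/-- Detailed balance: with respect to the thermal state, the generator acts on the density `A` of
`A e^{-βH}` through `densityGenerator`. The jump `E_μ(ω)` is the adjoint of `E_{-μ}(-ω)`, and the
factor `e^{βħω}` from moving `e^{-βH}` through a jump turns `Γ_ω` into `Γ_{-ω}`. -/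
theorem lindblad_mul_exp (hc : IsNormalisation c)
    (hneg : ∀ ω ∈ bohrFrequencies ħ hH, ∀ μ ν, Γ ω μ.neg ν.neg = Γ ω μ ν)
    (hbalance : ∀ ω ∈ bohrFrequencies ħ hH, ∀ μ ν,
      Γ (-ω) μ ν = (Real.exp (β * ħ * ω) : ℂ) * Γ ω ν μ) (A : Op n d) :
    lindblad ħ hH c Γ (A * NormedSpace.exp (-(β : ℂ) • H)) =
      densityGenerator (-(Complex.I / (ħ : ℂ))) H (bohrFrequencies ħ hH)
        (fun μ ω => bohrComponent ħ hH (generatorE n c μ) ω) Γ A *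
          NormedSpace.exp (-(β : ℂ) • H) := by
  set τ := NormedSpace.exp (-(β : ℂ) • H) with hτ
  have hHτ : Commute H τ := ((Commute.refl H).smul_right _).exp_right
  set E : Root d → ℝ → Op n d := fun μ ω => bohrComponent ħ hH (generatorE n c μ) ω with hE
  have hadj (μ ω) : (E μ ω)ᴴ = E μ.neg (-ω) := by
    simp only [hE]
    rw [bohrComponent_conjTranspose, generatorE_conjTranspose hc]
  have hEτ (μ ω) : E μ ω * τ = (Real.exp (β * ħ * ω) : ℂ) • (τ * E μ ω) :=
    bohrComponent_mul_exp ħ hH β _ ω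
  have hτE (μ ω) : τ * (E μ ω)ᴴ = (Real.exp (β * ħ * ω) : ℂ) • ((E μ ω)ᴴ * τ) := by
    rw [hadj, hEτ, smul_smul, ← Complex.ofReal_mul, ← Real.exp_add, mul_neg, add_neg_cancel,
      Real.exp_zero, Complex.ofReal_one, one_smul]
  have hEEτ (μ ν ω) : τ * ((E ν ω)ᴴ * E μ ω) = (E ν ω)ᴴ * E μ ω * τ := by
    rw [← Matrix.mul_assoc, hτE, Matrix.smul_mul, Matrix.mul_assoc, ← Matrix.mul_smul, ← hEτ,
      Matrix.mul_assoc]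
  have hswap : ∑ ω ∈ bohrFrequencies ħ hH, ∑ μ, ∑ ν,
      Γ ω μ ν • (E μ ω * (A * τ) * (E ν ω)ᴴ) =
      ∑ ω ∈ bohrFrequencies ħ hH, ∑ μ, ∑ ν, Γ ω μ ν • ((E ν ω)ᴴ * A * E μ ω * τ) := by
    rw [← sum_bohrFrequencies_neg]
    refine Finset.sum_congr rfl fun ω hω => ?_
    rw [Finset.sum_comm, ← sum_root_neg]
    refine Finset.sum_congr rfl fun μ _ => ?_
    rw [← sum_root_neg]
    refine Finset.sum_congr rfl fun ν _ => ?_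
    have h1 : E ν.neg (-ω) * (A * τ) * (E μ.neg (-ω))ᴴ =
        (Real.exp (β * ħ * -ω) : ℂ) • ((E ν ω)ᴴ * A * E μ ω * τ) := by
      rw [Matrix.mul_assoc, Matrix.mul_assoc A, hτE, hadj μ.neg, ← hadj ν, Root.neg_neg,
        _root_.neg_neg]
      simp only [Matrix.mul_smul, Matrix.mul_assoc]
    have h2 : Γ (-ω) ν.neg μ.neg * (Real.exp (β * ħ * -ω) : ℂ) = Γ ω μ ν := by
      rw [hneg _ (neg_mem_bohrFrequencies ħ hH hω), hbalance ω hω, mul_right_comm,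
        ← Complex.ofReal_mul, ← Real.exp_add]
      simp
    rw [h1, smul_smul, h2]
  have hrest (ω μ ν) : (1 / 2 : ℂ) • ((E ν ω)ᴴ * E μ ω * (A * τ) +
      A * τ * ((E ν ω)ᴴ * E μ ω)) =
      (1 / 2 : ℂ) • ((E ν ω)ᴴ * E μ ω * A + A * ((E ν ω)ᴴ * E μ ω)) * τ := by
    rw [Matrix.smul_mul, Matrix.mul_assoc A τ, hEEτ, Matrix.add_mul]
    simp only [Matrix.mul_assoc]
  have hcomm : H * (A * τ) - A * τ * H = (H * A - A * H) * τ := by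
    rw [Matrix.mul_assoc A τ, ← hHτ.eq, Matrix.sub_mul]
    simp only [Matrix.mul_assoc]
  change _ • (H * (A * τ) - A * τ * H) + ∑ ω ∈ bohrFrequencies ħ hH, ∑ μ, ∑ ν, Γ ω μ ν •
    (E μ ω * (A * τ) * (E ν ω)ᴴ - (1 / 2 : ℂ) • ((E ν ω)ᴴ * E μ ω * (A * τ) +
      A * τ * ((E ν ω)ᴴ * E μ ω))) = _
  simp only [densityGenerator, hrest, hcomm, smul_sub (Γ _ _ _), Finset.sum_sub_distrib, hswap]
  simp only [Matrix.add_mul, Matrix.sub_mul, Matrix.sum_mul, Matrix.smul_mul]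

end Lindblad

/-! ### Simple roots generate the collective algebra -/

section Roots

variable {n d : ℕ}

theorem IsSimpleRoots.reflTransGen {R : Set (Root d)} (hR : IsSimpleRoots R) (a b : Fin d) :
    Relation.ReflTransGen (fun x y => ∃ μ ∈ R, μ.1 = (x, y) ∨ μ.1 = (y, x)) a b := by
  classical
  set r : Fin d → Fin d → Prop := fun x y => ∃ μ ∈ R, μ.1 = (x, y) ∨ μ.1 = (y, x) with hr
  by_cases hab : a = b
  · exact hab ▸ Relation.ReflTransGen.refl
  -- The indicator function of the connected component of `a` is orthogonal to all roots in `R`,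
  -- hence to all roots.
  let f : Fin d → ℝ := fun x => if Relation.ReflTransGen r a x then 1 else 0
  have hvec (μ : Root d) : f ⬝ᵥ μ.vec = f μ.1.1 - f μ.1.2 := by
    simp [Root.vec, dotProduct_sub]
  have hker : AddSubmonoid.closure (Root.vec '' R) ≤
      AddMonoidHom.mker (AddMonoidHom.mk' (fun v : Fin d → ℝ => f ⬝ᵥ v) (dotProduct_add f)) := by
    rw [AddSubmonoid.closure_le]
    rintro _ ⟨μ, hμ, rfl⟩
    change f ⬝ᵥ μ.vec = 0
    have hiff : Relation.ReflTransGen r a μ.1.1 ↔ Relation.ReflTransGen r a μ.1.2 :=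
      ⟨fun h => h.tail ⟨μ, hμ, Or.inl rfl⟩, fun h => h.tail ⟨μ, hμ, Or.inr rfl⟩⟩
    rw [hvec]
    simp [f, hiff]
  have h0 : f ⬝ᵥ Root.vec (⟨(a, b), hab⟩ : Root d) = 0 := by
    rcases hR.2 ⟨(a, b), hab⟩ with h | h
    · exact hker h
    · have h1 : f ⬝ᵥ (-Root.vec (⟨(a, b), hab⟩ : Root d)) = 0 := hker h
      rwa [dotProduct_neg, neg_eq_zero] at h1
  rw [hvec] at h0
  by_contra hn
  have ha : f a = 1 := if_pos Relation.ReflTransGen.refl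
  have hb : f b = 0 := if_neg hn
  simp [ha, hb] at h0

theorem commute_collective_single_mul {A : Op n d} {a b c : Fin d} (hac : a ≠ c)
    (hab : Commute A (collective n (Matrix.single a b 1)))
    (hbc : Commute A (collective n (Matrix.single b c 1))) :
    Commute A (collective n (Matrix.single a c 1)) := by
  have h := collective_bracket (n := n) (Matrix.single a b (1 : ℂ)) (Matrix.single b c 1)
  rw [Matrix.single_mul_single_same, Matrix.single_mul_single_of_ne _ _ _ _ hac.symm, sub_zero,
    mul_one] at h
  rw [← h]
  exact (hab.mul_right hbc).sub_right (hbc.mul_right hab)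

/-- Simple roots connect all levels, so brackets of the corresponding generators yield all
`|a⟩⟨b|` with `a ≠ b`, hence all traceless matrices; the identity acts as a scalar. -/
theorem IsSimpleRoots.commute_collective {R : Set (Root d)} (hR : IsSimpleRoots R) {A : Op n d}
    (h : ∀ μ ∈ R, Commute A (collective n (Matrix.single μ.1.1 μ.1.2 1)))
    (h' : ∀ μ ∈ R, Commute A (collective n (Matrix.single μ.1.2 μ.1.1 1)))
    (x : Matrix (Fin d) (Fin d) ℂ) : Commute A (collective n x) := by
  have hconn (a b : Fin d) : a = b ∨ (Commute A (collective n (Matrix.single a b 1)) ∧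
      Commute A (collective n (Matrix.single b a 1))) := by
    induction hR.reflTransGen a b with
    | refl => exact Or.inl rfl
    | @tail b c _ hbc ih =>
      have hbc' : Commute A (collective n (Matrix.single b c 1)) ∧
          Commute A (collective n (Matrix.single c b 1)) := by
        obtain ⟨μ, hμ, hμ' | hμ'⟩ := hbc
        · have h1 := h μ hμ
          have h2 := h' μ hμ
          rw [hμ'] at h1 h2
          exact ⟨h1, h2⟩
        · have h1 := h μ hμ
          have h2 := h' μ hμ
          rw [hμ'] at h1 h2
          exact ⟨h2, h1⟩
      by_cases hac : a = c
      · exact Or.inl hac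
      · rcases ih with rfl | ih
        · exact Or.inr hbc'
        · exact Or.inr ⟨commute_collective_single_mul hac ih.1 hbc'.1,
            commute_collective_single_mul (Ne.symm hac) hbc'.2 ih.2⟩
  have hdiff (a b : Fin d) : Commute A
      (collective n (Matrix.single a a 1) - collective n (Matrix.single b b 1)) := by
    rcases hconn a b with rfl | hab
    · rw [sub_self]
      exact Commute.zero_right A
    · have h1 := collective_bracket (n := n) (Matrix.single a b (1 : ℂ)) (Matrix.single b a 1)
      rw [Matrix.single_mul_single_same, Matrix.single_mul_single_same, mul_one,
        ← collectiveLinear_apply (_ - _), map_sub] at h1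
      simp only [collectiveLinear_apply] at h1
      rw [← h1]
      exact (hab.1.mul_right hab.2).sub_right (hab.2.mul_right hab.1)
  have hone : ∑ b : Fin d, Matrix.single b b (1 : ℂ) = 1 := by
    ext i j
    simp [Matrix.sum_apply, Matrix.single_apply, Matrix.one_apply, ite_and]
  have hdiag (a : Fin d) : Commute A (collective n (Matrix.single a a 1)) := by
    have hd : (d : ℂ) ≠ 0 := Nat.cast_ne_zero.mpr (Nat.pos_iff_ne_zero.mp a.pos)
    have h1 : (d : ℂ) • collective n (Matrix.single a a 1) =
        ∑ b, (collective n (Matrix.single a a 1) - collective n (Matrix.single b b 1)) +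
          (n : ℂ) • 1 := by
      rw [← collective_one (d := d), ← hone, ← collectiveLinear_apply (∑ b, _), map_sum,
        Finset.sum_sub_distrib, Finset.sum_const, Finset.card_univ, Fintype.card_fin,
        Nat.cast_smul_eq_nsmul]
      simp only [collectiveLinear_apply, sub_add_cancel]
    have h2 : Commute A ((d : ℂ) • collective n (Matrix.single a a 1)) := by
      rw [h1]
      exact (Commute.sum_right _ _ _ fun b _ => hdiff a b).add_right
        ((Commute.one_right A).smul_right _)
    simpa [smul_smul, inv_mul_cancel₀ hd] using h2.smul_right (d : ℂ)⁻¹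
  have hall (a b : Fin d) : Commute A (collective n (Matrix.single a b 1)) := by
    rcases hconn a b with rfl | hab
    · exact hdiag a
    · exact hab.1
  rw [Matrix.matrix_eq_sum_single x, ← collectiveLinear_apply]
  simp only [map_sum]
  refine Commute.sum_right _ _ _ fun a _ => Commute.sum_right _ _ _ fun b _ => ?_
  have h1 : Matrix.single a b (x a b) = x a b • Matrix.single a b 1 := by
    rw [Matrix.smul_single, smul_eq_mul, mul_one]
  rw [h1, map_smul, collectiveLinear_apply]
  exact (hall a b).smul_right _

theorem generatorE_eq_smul (c : Root d → ℂ) (μ : Root d) :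
    generatorE n c μ = c μ • collective n (Matrix.single μ.1.1 μ.1.2 1) := by
  rw [generatorE, ← collectiveLinear_apply (Matrix.single μ.1.1 μ.1.2 1), ← map_smul,
    Matrix.smul_single, smul_eq_mul, mul_one]
  rfl

theorem IsNormalisation.commute_collective_iff {c : Root d → ℂ} (hc : IsNormalisation c)
    {A : Op n d} (μ : Root d) : Commute A (generatorE n c μ) ↔
      Commute A (collective n (Matrix.single μ.1.1 μ.1.2 1)) := by
  rw [generatorE_eq_smul, Commute.smul_right_iff₀ (hc μ).1]

end Roots

/-! ### Steady states -/

/-- A positive semidefinite matrix is its trace times a density matrix, which is arbitrary if the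
trace is zero. -/
theorem exists_eq_smul_isDensity {m : ℕ} (hm : 0 < m)
    {q : Matrix (Fin m) (Fin m) ℂ} (hq : q.PosSemidef) :
    ∃ (p : ℝ) (σ : Matrix (Fin m) (Fin m) ℂ),
      0 ≤ p ∧ IsDensity σ ∧ q = (p : ℂ) • σ ∧ q.trace = p := by
  have htr := Complex.nonneg_iff.mp hq.trace_nonneg
  have htr' : q.trace = (q.trace.re : ℂ) := Complex.ext rfl htr.2.symm
  by_cases h0 : q.trace.re = 0
  · have hq0 : q = 0 := by
      rw [← hq.trace_eq_zero_iff, htr', h0, Complex.ofReal_zero]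
    refine ⟨0, Matrix.diagonal (Pi.single ⟨0, hm⟩ 1), le_rfl, ⟨?_, ?_⟩, ?_, ?_⟩
    · refine Matrix.PosSemidef.diagonal fun i => ?_
      rw [Pi.single_apply]
      split_ifs <;> simp
    · simp [Matrix.trace_diagonal]
    · simp [hq0]
    · simp [hq0]
  · refine ⟨q.trace.re, (q.trace.re : ℂ)⁻¹ • q, htr.1, ⟨?_, ?_⟩, ?_, htr'⟩
    · refine hq.smul ?_
      rw [← Complex.ofReal_inv]
      exact Complex.zero_le_real.mpr (inv_nonneg.mpr htr.1)
    · rw [Matrix.trace_smul, ← htr', smul_eq_mul, inv_mul_cancel₀]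
      rw [htr']
      exact_mod_cast h0
    · rw [smul_smul, mul_inv_cancel₀ (by exact_mod_cast h0), one_smul]

theorem gibbs_isDensity {k : ℕ} (hk : 0 < k) (β : ℝ) {H : Matrix (Fin k) (Fin k) ℂ}
    (hH : H.IsHermitian) : IsDensity (gibbs β H) := by
  have := Fin.pos_iff_nonempty.mp hk
  have hpos := posDef_exp_of_isHermitian (isHermitian_ofReal_smul hH β)
  have htr := hpos.trace_pos
  refine ⟨hpos.posSemidef.smul (inv_nonneg.mpr htr.le), ?_⟩
  rw [gibbs, Matrix.trace_smul, smul_eq_mul, inv_mul_cancel₀ htr.ne']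

section SteadyStates

variable {n d : ℕ} {ħ β : ℝ} {H : Op n d} {hH : H.IsHermitian} {c : Root d → ℂ}
  {Γ : ℝ → Matrix (Root d) (Root d) ℂ} {R : Set (Root d)}

/-- A steady state `A e^{-βH}` has vanishing Dirichlet form, so full rank of `Γ_ω` over the simple
roots makes `A` and `A†` commute with the generators of these roots. -/
theorem commute_collective_of_lindblad_eq_zero (hħ : 0 < ħ) (hc : IsNormalisation c)
    (hpos : ∀ ω ∈ bohrFrequencies ħ hH, (Γ ω).PosSemidef)
    (hneg : ∀ ω ∈ bohrFrequencies ħ hH, ∀ μ ν, Γ ω μ.neg ν.neg = Γ ω μ ν)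
    (hbalance : ∀ ω ∈ bohrFrequencies ħ hH, ∀ μ ν,
      Γ (-ω) μ ν = (Real.exp (β * ħ * ω) : ℂ) * Γ ω ν μ)
    (hR : IsSimpleRoots R)
    (hrank : ∀ ω ∈ bohrFrequencies ħ hH, HasFullRankOver R
      (fun μ => bohrComponent ħ hH (generatorE n c μ) ω) (Γ ω))
    {A : Op n d} (hL : lindblad ħ hH c Γ (A * NormedSpace.exp (-(β : ℂ) • H)) = 0)
    (x : Matrix (Fin d) (Fin d) ℂ) : Commute A (collective n x) := by
  set E : Root d → ℝ → Op n d := fun μ ω => bohrComponent ħ hH (generatorE n c μ) ω with hE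
  set κ : ℂ := -(Complex.I / (ħ : ℂ)) with hκ
  have hκ' : star κ = -κ := by
    simp [hκ, neg_div]
  set S := NormedSpace.exp (-((β / 2 : ℝ) : ℂ) • H) with hS
  have hSS : S * Sᴴ = NormedSpace.exp (-(β : ℂ) • H) := by
    rw [hS, (isHermitian_ofReal_smul hH (β / 2)).exp.eq,
      ← Matrix.exp_add_of_commute _ _ (Commute.refl _), ← add_smul]
    congr 2
    push_cast
    ring
  have hK := lindblad_mul_exp (β := β) hc hneg hbalance A
  rw [hL] at hK
  have hKA : densityGenerator κ H (bohrFrequencies ħ hH) E Γ A = 0 :=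
    (Matrix.isUnit_exp (-(β : ℂ) • H)).mul_left_eq_zero.mp hK.symm
  have hKA' : densityGenerator κ H (bohrFrequencies ħ hH) E Γ Aᴴ = 0 := by
    rw [densityGenerator_conjTranspose hκ' hH fun ω hω => (hpos ω hω).isHermitian, hKA,
      Matrix.conjTranspose_zero]
  have htr (B : Op n d) :
      (densityGenerator κ H (bohrFrequencies ħ hH) E Γ B * (S * Sᴴ)).trace = 0 := by
    rw [hSS, ← lindblad_mul_exp hc hneg hbalance]
    exact trace_stateGenerator _
  have key {B : Op n d} (hB : densityGenerator κ H (bohrFrequencies ħ hH) E Γ B = 0)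
      (hB' : densityGenerator κ H (bohrFrequencies ħ hH) E Γ Bᴴ = 0) (μ : Root d) (hμ : μ ∈ R) :
      Commute B (generatorE n c μ) := by
    rw [← sum_bohrComponent hH hħ.ne' (generatorE n c μ)]
    refine Commute.sum_right _ _ _ fun ω hω => ?_
    by_cases h0 : E μ ω = 0
    · change Commute B (E μ ω)
      rw [h0]
      exact Commute.zero_right B
    · have h1 (i j) : star ((B * E μ ω - E μ ω * B) i j) = 0 := by
        refine hrank ω hω (fun μ => star ((B * E μ ω - E μ ω * B) i j)) (fun ν hν => ?_)
          (fun ν _ => ?_) μ hμ h0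
        · have hν' : E ν ω = 0 := hν
          simp [hν']
        · rw [mulVec_eq_zero_of_densityGenerator hpos (Matrix.isUnit_exp _) htr hB hB' hω i j]
          rfl
      refine sub_eq_zero.mp ?_
      ext i j
      exact star_eq_zero.mp (h1 i j)
  refine hR.commute_collective (fun μ hμ => ?_) (fun μ hμ => ?_) x
  · exact (hc.commute_collective_iff μ).mp (key hKA hKA' μ hμ)
  · have h1 := key hKA' (by rw [Matrix.conjTranspose_conjTranspose]; exact hKA) μ hμ
    have h2 := congrArg Matrix.conjTranspose h1.eq
    rw [Matrix.conjTranspose_mul, Matrix.conjTranspose_mul, Matrix.conjTranspose_conjTranspose,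
      generatorE_conjTranspose hc] at h2
    exact (hc.commute_collective_iff μ.neg).mp h2.symm

/-- Operators that commute with all collective operators commute with `H` and with all jump
operators, so `densityGenerator` annihilates them. -/
theorem lindblad_eq_zero_of_commute_collective (hc : IsNormalisation c)
    (hperm : IsPermInvariant H)
    (hneg : ∀ ω ∈ bohrFrequencies ħ hH, ∀ μ ν, Γ ω μ.neg ν.neg = Γ ω μ ν)
    (hbalance : ∀ ω ∈ bohrFrequencies ħ hH, ∀ μ ν,
      Γ (-ω) μ ν = (Real.exp (β * ħ * ω) : ℂ) * Γ ω ν μ)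
    {A : Op n d} (hA : ∀ x : Matrix (Fin d) (Fin d) ℂ, Commute A (collective n x)) :
    lindblad ħ hH c Γ (A * NormedSpace.exp (-(β : ℂ) • H)) = 0 := by
  have hAH : Commute A H := hperm.commute (commute_tensorPower_of_collective hA)
  rw [lindblad_mul_exp hc hneg hbalance, densityGenerator_eq_zero_of_commute hAH, Matrix.zero_mul]
  · exact fun μ ω => commute_bohrComponent ħ hH hAH (hA _) ω
  · intro μ ω
    rw [bohrComponent_conjTranspose, generatorE_conjTranspose hc]
    exact commute_bohrComponent ħ hH hAH (hA _) _

end SteadyStates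

theorem SchurBasis.commute_collective_blockOp {n d : ℕ} (S : SchurBasis n d)
    (Q : ∀ l, Matrix (Fin (S.m l)) (Fin (S.m l)) ℂ) (x : Matrix (Fin d) (Fin d) ℂ) :
    Commute (S.blockOp Q fun _ => 1) (collective n x) := by
  refine commute_collective_of_specialUnitary (fun u => ?_) x
  rw [S.tensorPower_eq_blockOp, Commute, SemiconjBy, S.blockOp_mul, S.blockOp_mul]
  simp

theorem SchurBasis.blockOp_smul_smul {n d : ℕ} (S : SchurBasis n d)
    {a b : S.Λ → ℂ} (hab : ∀ l, a l * b l = 1)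
    (A : ∀ l, Matrix (Fin (S.m l)) (Fin (S.m l)) ℂ)
    (B : ∀ l, Matrix (Fin (S.k l)) (Fin (S.k l)) ℂ) :
    S.blockOp (fun l => a l • A l) (fun l => b l • B l) = S.blockOp A B := by
  simp only [SchurBasis.blockOp, Matrix.smul_kronecker, Matrix.kronecker_smul, smul_smul,
    mul_comm (b _), hab, one_smul]

end CollectiveThermal

theorem corollary1 (n d : ℕ) (ħ β : ℝ) (hħ : 0 < ħ)
    (H : CollectiveThermal.Op n d) (hH : H.IsHermitian)
    (hperm : CollectiveThermal.IsPermInvariant H)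
    (c : CollectiveThermal.Root d → ℂ) (hc : CollectiveThermal.IsNormalisation c)
    (Γ : ℝ → Matrix (CollectiveThermal.Root d) (CollectiveThermal.Root d) ℂ)
    (hpos : ∀ ω ∈ CollectiveThermal.bohrFrequencies ħ hH, (Γ ω).PosSemidef)
    (hneg : ∀ ω ∈ CollectiveThermal.bohrFrequencies ħ hH, ∀ μ ν,
      Γ ω μ.neg ν.neg = Γ ω μ ν)
    (hbalance : ∀ ω ∈ CollectiveThermal.bohrFrequencies ħ hH, ∀ μ ν,
      Γ (-ω) μ ν = (Real.exp (β * ħ * ω) : ℂ) * Γ ω ν μ)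
    (R : Set (CollectiveThermal.Root d)) (hR : CollectiveThermal.IsSimpleRoots R)
    (hrank : ∀ ω ∈ CollectiveThermal.bohrFrequencies ħ hH,
      CollectiveThermal.HasFullRankOver R
        (fun μ => CollectiveThermal.bohrComponent ħ hH (CollectiveThermal.generatorE n c μ) ω)
        (Γ ω)) :
    Nonempty (CollectiveThermal.SchurBasis n d) ∧
    ∀ S : CollectiveThermal.SchurBasis n d,
      ∃ Hb : ∀ l, Matrix (Fin (S.k l)) (Fin (S.k l)) ℂ,
        H = S.blockOp (fun _ => 1) Hb ∧
        ∀ ρ : CollectiveThermal.Op n d,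
          (CollectiveThermal.IsDensity ρ ∧ CollectiveThermal.lindblad ħ hH c Γ ρ = 0) ↔
          ∃ (p : S.Λ → ℝ) (σ : ∀ l, Matrix (Fin (S.m l)) (Fin (S.m l)) ℂ),
            (∀ l, 0 ≤ p l) ∧ ∑ l, p l = 1 ∧ (∀ l, CollectiveThermal.IsDensity (σ l)) ∧
            ρ = S.blockOp (fun l => (p l : ℂ) • σ l)
              (fun l => CollectiveThermal.gibbs β (Hb l)) := by
  open CollectiveThermal in
  refine ⟨nonempty_schurBasis n d, fun S => ?_⟩
  obtain ⟨Hb, hHb⟩ := S.exists_eq_blockOp_of_isPermInvariant hperm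
  refine ⟨Hb, hHb, fun ρ => ?_⟩
  have hHbh (l) : (Hb l).IsHermitian := S.isHermitian_of_blockOp (hHb ▸ hH) l
  set g : ∀ l, Matrix (Fin (S.k l)) (Fin (S.k l)) ℂ :=
    fun l => NormedSpace.exp (-(β : ℂ) • Hb l) with hg
  have hgpos (l) : (g l).PosDef := posDef_exp_of_isHermitian (isHermitian_ofReal_smul (hHbh l) β)
  have htrg (l) : 0 < (g l).trace :=
    have := Fin.pos_iff_nonempty.mp (S.k_pos l)
    (hgpos l).trace_pos
  have hgibbs (l) : gibbs β (Hb l) = (g l).trace⁻¹ • g l := rfl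
  have hτ : NormedSpace.exp (-(β : ℂ) • H) = S.blockOp (fun _ => 1) g := by
    rw [hg, ← S.exp_blockOp, hHb]
    exact congrArg NormedSpace.exp (map_smul S.blockHom (-(β : ℂ)) Hb).symm
  have hmulτ (Q : ∀ l, Matrix (Fin (S.m l)) (Fin (S.m l)) ℂ) :
      S.blockOp Q (fun _ => 1) * NormedSpace.exp (-(β : ℂ) • H) = S.blockOp Q g := by
    rw [hτ, S.blockOp_mul]
    simp
  constructor
  · rintro ⟨⟨hρpos, hρtr⟩, hL⟩
    obtain ⟨A, rfl⟩ : ∃ A, ρ = A * NormedSpace.exp (-(β : ℂ) • H) := by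
      obtain ⟨u, hu⟩ := Matrix.isUnit_exp (-(β : ℂ) • H)
      exact ⟨ρ * ↑u⁻¹, by rw [← hu, Matrix.mul_assoc, Units.inv_mul, Matrix.mul_one]⟩
    obtain ⟨Q, rfl⟩ := S.exists_eq_blockOp_of_commute_tensorPower fun u =>
      commute_tensorPower_of_collective (commute_collective_of_lindblad_eq_zero hħ hc hpos hneg
        hbalance hR hrank hL) u
    rw [hmulτ] at hρpos hρtr ⊢
    choose p σ hp hσ hpσ htr using fun l =>
      exists_eq_smul_isDensity (S.m_pos l) (S.posSemidef_smul_of_blockOp hρpos l)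
    refine ⟨p, σ, hp, ?_, hσ, ?_⟩
    · rw [S.trace_blockOp] at hρtr
      have h1 : ∑ l, (p l : ℂ) = 1 := by
        rw [← hρtr]
        refine Finset.sum_congr rfl fun l _ => ?_
        rw [← htr, Matrix.trace_smul, smul_eq_mul, mul_comm]
      exact_mod_cast h1
    · simp only [← hpσ, hgibbs]
      exact (S.blockOp_smul_smul (fun l => mul_inv_cancel₀ (htrg l).ne') Q g).symm
  · rintro ⟨p, σ, hp, hsum, hσ, rfl⟩
    have hγ (l) := gibbs_isDensity (S.k_pos l) β (hHbh l)
    refine ⟨⟨S.posSemidef_blockOp (fun l => (hσ l).1.smul (Complex.zero_le_real.mpr (hp l)))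
      fun l => (hγ l).1, ?_⟩, ?_⟩
    · rw [S.trace_blockOp]
      simp only [Matrix.trace_smul, (hσ _).2, (hγ _).2, smul_eq_mul, mul_one]
      exact_mod_cast hsum
    · have h1 : S.blockOp (fun l => (p l : ℂ) • σ l) (fun l => gibbs β (Hb l)) =
          S.blockOp (fun l => (g l).trace⁻¹ • (p l : ℂ) • σ l) (fun _ => 1) *
            NormedSpace.exp (-(β : ℂ) • H) := by
        rw [hmulτ, ← S.blockOp_smul_smul (fun l => inv_mul_cancel₀ (htrg l).ne')
          (fun l => (p l : ℂ) • σ l) fun l => gibbs β (Hb l)]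
        simp only [hgibbs, smul_inv_smul₀ (htrg _).ne']
      rw [h1]
      exact lindblad_eq_zero_of_commute_collective hc hperm hneg hbalance
        (S.commute_collective_blockOp _)
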